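/- Let $\mathcal H$ be a complex Hilbert space and $\pi:\mathrm U(1)\to\mathcal U(\mathcal H)$ a strongly continuous unitary representation with charge operator $X$, i.e. $\pi(e^{i\alpha})=\exp(i\alpha X)$. For $\mu\in\mathbb Z$ let $X^{(\mu)}$ be the orthogonal projection onto $\mathcal H^{(\mu)}=\{\psi\in D(X): X\psi=\mu\psi\}$. Assume that every $\mathcal H^{(\mu)}$ is finite-dimensional and that $\mathcal H^{(\mu)}=\{0\}$ for $\mu<0$. Let $D_X$ be the set of all $\psi\in\mathcal H$ with $X^{(\mu)}\psi=0$ for all but finitely many $\mu$, and let $\mathcal{SU}(X)$ be the group of unitaries $U$ that commute with all $\pi(z)$ and satisfy $\det\big(X^{(\mu)}UX^{(\mu)}|_{\mathcal H^{(\mu)}}\big)=1$ for all $\mu$. A selfadjoint operator commutes with $X$ if it commutes with all the projections $X^{(\mu)}$ (domains included). The dynamical group generated by selfadjoint operators $A_1,\dots,A_m$ is the smallest subgroup of $\mathcal U(\mathcal H)$ that is closed in the strong operator topology of $\mathcal U(\mathcal H)$ and contains all $\exp(itA_k)$, $t\in\mathbb R$. A selfadjoint operator $H$ with domain $D(H)$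 is called complementary to $X$ if there are mutually orthogonal projections $E_-,E_0,E_+$ with $E_-+E_0+E_+=\mathbb 1$, commuting with all $X^{(\mu)}$, such that $X^{(\mu)}_\pm:=X^{(\mu)}E_\pm\neq0$ for all $\mu\ge1$, $X^{(0)}E_-=X^{(0)}$, and: 1. $E_0\mathcal H\subset D(H)$ and $H\psi=0$ for all $\psi\in E_0\mathcal H$; 2. $D_X\subset D(H)$, and for all integers $\mu\ge1$ and all $\psi\in D_X$ we have $HX_+^{(\mu+1)}\psi=X_-^{(\mu)}H\psi$; moreover $X_-^{(\mu)}HX_+^{(\mu+1)}$ is a (bounded) partial isometry with source projection $X_+^{(\mu+1)}$ and target projection $X_-^{(\mu)}$; 3. with $F=X^{(0)}+X_+^{(1)}$, the group generated by all $\exp(itH)$, $t\in\mathbb R$, and by those $U\in\mathcal{SU}(X)$ that commute with $F$ leaves $F\mathcal H$ invariant and acts transitively on the one-dimensional subspaces of $F\mathcal H$. Let $d\ge1$ and let $H_1,\dots,H_d$ be selfadjoint operators on $\mathcal H$ such that $H_1,\dots,H_{d-1}$ commute with $X$, the dynamical group generated by $H_1,\dots,H_{d-1}$ contains $\mathcal{SU}(X)$,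 and $H_d$ is complementary to $X$. Then the control system with Hamiltonians $H_0=\mathbb 1,H_1,\dots,H_d$ is pure-state controllable: for all unit vectors $\psi_0,\psi\in\mathcal H$ and every $\epsilon>0$ there are a finite time $T>0$ and piecewise constant real control functions $u_0,\dots,u_d$ on $[0,T]$, at most one of which is non-zero at each time, such that the resulting propagator $U(0,T)$, a finite product of unitaries $\exp(-i\tau u H_k)$ with $\tau>0$ the length of an interval of constancy and $u$ the value of the active control $u_k$ on it, satisfies $\|\psi-U(0,T)\psi_0\|<\epsilon$. -/

import Mathlib

noncomputable section

namespace QControl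

variable {E : Type*} [NormedAddCommGroup E] [InnerProductSpace ℂ E] [CompleteSpace E]

/-! ### Unbounded selfadjoint operators and the unitary groups they generate

An unbounded operator is a `LinearPMap`; it is selfadjoint if `IsSelfAdjoint`, i.e. if it is
densely defined and equal to its adjoint, including domains. -/

/-- A family of unitaries is strongly continuous. -/
def StronglyContinuous {T : Type*} [TopologicalSpace T] (U : T → unitary (E →L[ℂ] E)) : Prop :=
  ∀ ψ : E, Continuous fun t => (U t : E →L[ℂ] E) ψ

/-- A strongly continuous one-parameter group of unitaries. -/
structure IsUnitaryGroup (U : ℝ → unitary (E →L[ℂ] E)) : Prop where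
  map_zero : U 0 = 1
  map_add : ∀ s t, U (s + t) = U s * U t
  strongCont : StronglyContinuous U

/-- The generator `A` of `U`, with the convention `U t = exp (i t A)`: the domain consists of the
vectors `ψ` for which `t ↦ U t ψ` is differentiable at `0`, and `A ψ = -i (d/dt) U t ψ` at `0`. -/
def generator (U : ℝ → unitary (E →L[ℂ] E)) : E →ₗ.[ℂ] E where
  domain :=
    { carrier := {ψ | DifferentiableAt ℝ (fun t => (U t : E →L[ℂ] E) ψ) 0}
      add_mem' := by
        intro a b ha hb
        simpa only [Set.mem_ofPred_eq, map_add] using DifferentiableAt.fun_add ha hb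
      zero_mem' := by simp
      smul_mem' := by
        intro c a ha
        simpa only [Set.mem_ofPred_eq, map_smul] using DifferentiableAt.fun_const_smul ha c }
  toFun :=
    { toFun := fun ψ => -Complex.I • deriv (fun t => (U t : E →L[ℂ] E) (ψ : E)) 0
      map_add' := by
        rintro ⟨a, ha⟩ ⟨b, hb⟩
        have h := deriv_fun_add (𝕜 := ℝ) (F := E) ha hb
        simp only [Submodule.coe_add, map_add]
        rw [h, smul_add]
      map_smul' := by
        rintro c ⟨a, ha⟩
        have h := deriv_fun_const_smul (𝕜 := ℝ) (F := E) c ha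
        simp only [Submodule.coe_smul, map_smul, RingHom.id_apply]
        rw [h, smul_comm] }

open Classical in
/-- `expI A t = exp (i t A)` for a selfadjoint operator `A`: the strongly continuous one-parameter
unitary group with generator `A`, which exists and is unique by Stone's theorem. (The value is `1`
if there is no such group, which does not occur for selfadjoint `A`.) -/
def expI (A : E →ₗ.[ℂ] E) (t : ℝ) : unitary (E →L[ℂ] E) :=
  if h : ∃ U : ℝ → unitary (E →L[ℂ] E), IsUnitaryGroup U ∧ generator U = A then h.choose t else 1

/-- The identity operator, with all of `E` as its domain. -/
def idOp : E →ₗ.[ℂ] E := (LinearMap.id : E →ₗ[ℂ] E).toPMap ⊤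

/-! ### The dynamical group -/

/-- A set of unitaries is closed in the restriction of the strong operator topology to the
unitary group. -/
def IsStronglyClosed (S : Set (unitary (E →L[ℂ] E))) : Prop :=
  ∀ U : unitary (E →L[ℂ] E),
    (∀ (s : Finset E) (ε : ℝ), 0 < ε →
      ∃ V ∈ S, ∀ ψ ∈ s, ‖(V : E →L[ℂ] E) ψ - (U : E →L[ℂ] E) ψ‖ < ε) → U ∈ S

/-- The dynamical group generated by a family of Hamiltonians: the smallest strongly closed
subgroup of the unitary group that contains all `exp (i t A k)`. -/
def dynamicalGroup {ι : Type*} (A : ι → E →ₗ.[ℂ] E) : Subgroup (unitary (E →L[ℂ] E)) :=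
  sInf {G | IsStronglyClosed (G : Set (unitary (E →L[ℂ] E))) ∧ ∀ k t, expI (A k) t ∈ G}

/-! ### Control systems and pure-state controllability -/

/-- A time interval of length `duration` on which only the control `index` is switched on, with
constant value `amplitude`. -/
structure Pulse (ι : Type*) where
  index : ι
  amplitude : ℝ
  duration : ℝ
  duration_pos : 0 < duration

/-- The time evolution `U(0,T)` under a piecewise constant control, given as the list of its
pulses, first pulse first. -/
def propagator {ι : Type*} (A : ι → E →ₗ.[ℂ] E) : List (Pulse ι) → unitary (E →L[ℂ] E)
  | [] => 1
  | p :: ps => propagator A ps * expI (A p.index) (-(p.duration * p.amplitude))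

/-- `ψ` is reachable from `ψ₀`: it can be approximated up to any error in a finite time `T > 0`. -/
def Reachable {ι : Type*} (A : ι → E →ₗ.[ℂ] E) (ψ₀ ψ : E) : Prop :=
  ∀ ε : ℝ, 0 < ε → ∃ ps : List (Pulse ι), ps ≠ [] ∧
    ‖ψ - (propagator A ps : E →L[ℂ] E) ψ₀‖ < ε

/-- Every pure state is reachable from every other one. -/
def PureStateControllable {ι : Type*} (A : ι → E →ₗ.[ℂ] E) : Prop :=
  ∀ ψ₀ ψ : E, ‖ψ₀‖ = 1 → ‖ψ‖ = 1 → Reachable A ψ₀ ψ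

/-! ### The charge operator of a representation of `U(1)` -/

/-- The charge operator `X` of a representation `π` of `U(1)`: `π (e^{iα}) = exp (i α X)`. -/
def charge (π : Circle →* unitary (E →L[ℂ] E)) : E →ₗ.[ℂ] E :=
  generator fun α : ℝ => π (Circle.exp α)

/-- The eigenspace `{ψ ∈ D(A) | A ψ = c ψ}` of an operator. -/
def eigenspace (A : E →ₗ.[ℂ] E) (c : ℂ) : Submodule ℂ E :=
  A.graph.comap (LinearMap.id.prod (c • LinearMap.id))

/-- The eigenspace of the charge operator belonging to `μ`. -/
def sector (π : Circle →* unitary (E →L[ℂ] E)) (μ : ℤ) : Submodule ℂ E :=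
  eigenspace (charge π) (μ : ℂ)

/-- The eigenprojection `X^(μ)` of the charge operator. -/
def sectorProj (π : Circle →* unitary (E →L[ℂ] E)) [∀ μ, FiniteDimensional ℂ (sector π μ)]
    (μ : ℤ) : E →L[ℂ] E :=
  (sector π μ).starProjection

/-- The space `D_X` of finite particle vectors. -/
def IsFiniteParticle (π : Circle →* unitary (E →L[ℂ] E)) [∀ μ, FiniteDimensional ℂ (sector π μ)]
    (ψ : E) : Prop :=
  {μ : ℤ | sectorProj π μ ψ ≠ 0}.Finite

/-- A selfadjoint operator `A` commutes with the charge operator: it commutes (including domains)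
with all the eigenprojections of the charge operator, `X^(μ) A ⊆ A X^(μ)`. -/
def CommutesWithCharge (π : Circle →* unitary (E →L[ℂ] E))
    [∀ μ, FiniteDimensional ℂ (sector π μ)] (A : E →ₗ.[ℂ] E) : Prop :=
  ∀ (μ : ℤ) (ψ : A.domain), ∃ h : sectorProj π μ (ψ : E) ∈ A.domain,
    A ⟨sectorProj π μ (ψ : E), h⟩ = sectorProj π μ (A ψ)

/-- The block `U^(μ) = X^(μ) U X^(μ)` as an operator on the eigenspace. -/
def block (π : Circle →* unitary (E →L[ℂ] E)) [∀ μ, FiniteDimensional ℂ (sector π μ)]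
    (U : unitary (E →L[ℂ] E)) (μ : ℤ) : sector π μ →ₗ[ℂ] sector π μ :=
  (((sector π μ).orthogonalProjectionOnto ∘L (U : E →L[ℂ] E)) ∘L (sector π μ).subtypeL :
    sector π μ →L[ℂ] sector π μ)

/-- `SU(X)`: the unitaries that commute with all `π z` and all of whose blocks have
determinant `1`. -/
def specialUnitary (π : Circle →* unitary (E →L[ℂ] E)) [∀ μ, FiniteDimensional ℂ (sector π μ)] :
    Set (unitary (E →L[ℂ] E)) :=
  {U | (∀ z, Commute U (π z)) ∧ ∀ μ, LinearMap.det (block π U μ) = 1}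

/-! ### Operators complementary to the charge operator -/

/-- An orthogonal decomposition `E = E₋ ⊕ E₀ ⊕ E₊`, given by the projections `minus`, `zero` and
`plus`, that is compatible with the charge operator. -/
structure Splitting (π : Circle →* unitary (E →L[ℂ] E))
    [∀ μ, FiniteDimensional ℂ (sector π μ)] where
  minus : E →L[ℂ] E
  zero : E →L[ℂ] E
  plus : E →L[ℂ] E
  minus_proj : IsStarProjection minus
  zero_proj : IsStarProjection zero
  plus_proj : IsStarProjection plus
  minus_mul_zero : minus * zero = 0
  minus_mul_plus : minus * plus = 0
  zero_mul_plus : zero * plus = 0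
  sum_eq_one : minus + zero + plus = 1
  minus_comm : ∀ μ, Commute minus (sectorProj π μ)
  zero_comm : ∀ μ, Commute zero (sectorProj π μ)
  plus_comm : ∀ μ, Commute plus (sectorProj π μ)
  minus_ne_zero : ∀ μ : ℤ, 1 ≤ μ → sectorProj π μ * minus ≠ 0
  plus_ne_zero : ∀ μ : ℤ, 1 ≤ μ → sectorProj π μ * plus ≠ 0
  minus_sector_zero : sectorProj π 0 * minus = sectorProj π 0

variable {π : Circle →* unitary (E →L[ℂ] E)} [∀ μ, FiniteDimensional ℂ (sector π μ)]

/-- `X₋^(μ) = X^(μ) E₋`. -/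
def Splitting.Xminus (S : Splitting π) (μ : ℤ) : E →L[ℂ] E := sectorProj π μ * S.minus

/-- `X₊^(μ) = X^(μ) E₊`. -/
def Splitting.Xplus (S : Splitting π) (μ : ℤ) : E →L[ℂ] E := sectorProj π μ * S.plus

/-- The projection `F = X^(0) ⊕ X₊^(1)`. -/
def Splitting.F (S : Splitting π) : E →L[ℂ] E := sectorProj π 0 + S.Xplus 1

/-- The group generated by all `exp (i t A)` and by those elements of `SU(X)` that commute
with `F`. -/
def Splitting.lowGroup (S : Splitting π) (A : E →ₗ.[ℂ] E) : Subgroup (unitary (E →L[ℂ] E)) :=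
  Subgroup.closure
    (Set.range (expI A) ∪ {U | U ∈ specialUnitary π ∧ Commute (U : E →L[ℂ] E) S.F})

/-- The selfadjoint operator `A` is complementary to the charge operator, with respect to a given
splitting. -/
structure Splitting.IsCompl (S : Splitting π) (A : E →ₗ.[ℂ] E) : Prop where
  /-- `A` is defined on, and vanishes on, the range of the projection `E₀`. -/
  zero_on : ∀ ψ : E, S.zero ψ = ψ → ∃ h : ψ ∈ A.domain, A ⟨ψ, h⟩ = 0
  /-- The finite particle vectors belong to the domain of `A`. -/
  finiteParticle_mem : ∀ ψ : E, IsFiniteParticle π ψ → ψ ∈ A.domain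
  /-- `A X₊^(μ+1) ψ = X₋^(μ) A ψ` for finite particle vectors `ψ`. -/
  intertwine : ∀ μ : ℤ, 1 ≤ μ → ∀ ψ : A.domain, IsFiniteParticle π (ψ : E) →
    ∃ h : S.Xplus (μ + 1) (ψ : E) ∈ A.domain,
      A ⟨S.Xplus (μ + 1) (ψ : E), h⟩ = S.Xminus μ (A ψ)
  /-- `X₋^(μ) A X₊^(μ+1)` is a bounded operator `V`, and a partial isometry with source projection
  `X₊^(μ+1)` and target projection `X₋^(μ)`. -/
  partialIsometry : ∀ μ : ℤ, 1 ≤ μ → ∃ V : E →L[ℂ] E,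
    (∀ ψ : E, ∃ h : S.Xplus (μ + 1) ψ ∈ A.domain,
      V ψ = S.Xminus μ (A ⟨S.Xplus (μ + 1) ψ, h⟩)) ∧
    star V * V = S.Xplus (μ + 1) ∧ V * star V = S.Xminus μ
  /-- The group `lowGroup` acts on the range of `F` ... -/
  lowGroup_invariant : ∀ U ∈ S.lowGroup A, ∀ ψ : E, S.F ψ = ψ →
    S.F ((U : E →L[ℂ] E) ψ) = (U : E →L[ℂ] E) ψ
  /-- ... and it acts transitively on the one-dimensional subspaces of the range of `F`. -/
  lowGroup_transitive : ∀ φ ψ : E, ‖φ‖ = 1 → ‖ψ‖ = 1 → S.F φ = φ → S.F ψ = ψ →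
    ∃ U ∈ S.lowGroup A, ∃ c : ℂ, ‖c‖ = 1 ∧ (U : E →L[ℂ] E) φ = c • ψ

/-- The operator `A` is complementary to the charge operator of `π`. -/
def IsComplementary (π : Circle →* unitary (E →L[ℂ] E)) [∀ μ, FiniteDimensional ℂ (sector π μ)]
    (A : E →ₗ.[ℂ] E) : Prop :=
  ∃ S : Splitting π, S.IsCompl A

end QControl

end

/-!
Reachability is an equivalence relation, closed in `E × E`, so the unitaries moving every vector to
a reachable one form a strongly closed group; it contains the dynamical group, hence `SU(X)`, all
`exp (i t H)` for the complementary operator `H`, and all phases. It remains to steer every `ψ`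
with this group to `‖ψ‖ χ` for a fixed unit vector `χ` in the range of `F`. By closedness it is
enough to do so for `ψ` in the algebraic sum of the charge sectors, which is dense by Fourier
analysis of the matrix coefficients `⟪ψ, π z ψ⟫`.

If such a `ψ` has charge at most `N + 1`, products of two hyperplane reflections, which belong to
`SU(X)`, turn each of its components of charge `μ ≥ 1` into the range of `X₊^(μ)`. Since
`H X₊^(μ+1)` is a partial isometry whose adjoint is `H X₋^(μ)`, the square of `H` is the identity
on the ranges of `X₊^(μ+1)` and `X₋^(μ)`, so that `exp (i π/2 H) = i H` there: this unitary lowers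
all charges greater than `1` by one. On the range of `F` it acts as an element of the low group,
which leaves that range invariant. Iterating, the vector ends up in the range of `F`, where the low
group is transitive up to a phase.

No general form of Stone's theorem enters: `H` is isometric on the span of those ranges, because
it is symmetric with square `1` there, it vanishes on the range of `E₀`, and it is bounded on the
finite-dimensional range of `F`. Hence `H` is bounded, and `exp (i t H)` is a norm-convergent
series.
-/

open Complex

namespace QControl

section LinearPMap

variable {𝕜 E F : Type*} [NontriviallyNormedField 𝕜] [NormedAddCommGroup E] [NormedSpace 𝕜 E]
  [NormedAddCommGroup F] [NormedSpace 𝕜 F]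

theorem mem_graph_toPMap_top {B : E →L[𝕜] F} {x : E} {y : F} :
    (x, y) ∈ ((B : E →ₗ[𝕜] F).toPMap ⊤).graph ↔ B x = y := by
  simp [LinearPMap.mem_graph_iff]

theorem exists_eq_toPMap_top [CompleteSpace F] {A : E →ₗ.[𝕜] F} (hA : A.IsClosed)
    {D : Submodule 𝕜 E} (hD : Dense (D : Set E)) (hDA : D ≤ A.domain) {C : ℝ}
    (hC : ∀ x ∈ D, ∀ y, (x, y) ∈ A.graph → ‖y‖ ≤ C * ‖x‖) :
    ∃ B : E →L[𝕜] F, A = (B : E →ₗ[𝕜] F).toPMap ⊤ := by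
  let T : D →ₗ[𝕜] F := A.toFun ∘ₗ Submodule.inclusion hDA
  let B : E →L[𝕜] F := T.extendOfNorm D.subtype
  have T_mem_graph (x : D) : ((x : E), T x) ∈ A.graph := A.mem_graph (Submodule.inclusion hDA x)
  have B_mem_graph_of_mem (x : E) (hx : x ∈ D) : (x, B x) ∈ A.graph := by
    have hB : B x = T ⟨x, hx⟩ := T.extendOfNorm_eq (e := D.subtype) (by simpa [DenseRange] using hD)
      ⟨C, fun x => hC x x.2 _ (T_mem_graph x)⟩ ⟨x, hx⟩
    exact hB ▸ T_mem_graph ⟨x, hx⟩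
  have B_mem_graph (x : E) : (x, B x) ∈ A.graph :=
    hD.induction B_mem_graph_of_mem (hA.preimage (continuous_id.prodMk B.continuous)) x
  refine ⟨B, LinearPMap.eq_of_eq_graph (Submodule.ext fun ⟨x, y⟩ => ?_)⟩
  rw [mem_graph_toPMap_top]
  exact ⟨fun h => A.mem_graph_snd_inj (B_mem_graph x) h rfl, fun h => h ▸ B_mem_graph x⟩

theorem exists_norm_le_of_finiteDimensional [CompleteSpace 𝕜] (A : E →ₗ.[𝕜] F) {K : Submodule 𝕜 E}
    [FiniteDimensional 𝕜 K] (hK : K ≤ A.domain) :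
    ∃ C, 0 ≤ C ∧ ∀ x ∈ K, ∀ y, (x, y) ∈ A.graph → ‖y‖ ≤ C * ‖x‖ := by
  let T : K →L[𝕜] F := (A.toFun ∘ₗ Submodule.inclusion hK).toContinuousLinearMap
  refine ⟨‖T‖, norm_nonneg T, fun x hx y hxy => ?_⟩
  rw [(LinearPMap.image_iff (hK hx)).2 hxy]
  exact T.le_opNorm ⟨x, hx⟩

/-- The vectors in the domain of `A ^ 2` on which `A ^ 2` is the identity. -/
def involutive {R M : Type*} [Ring R] [AddCommGroup M] [Module R M] (A : M →ₗ.[R] M) :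
    Submodule R M where
  carrier := {x | ∃ y, (x, y) ∈ A.graph ∧ (y, x) ∈ A.graph}
  add_mem' := by
    rintro x x' ⟨y, hxy, hyx⟩ ⟨y', hxy', hyx'⟩
    exact ⟨y + y', A.graph.add_mem hxy hxy', A.graph.add_mem hyx hyx'⟩
  zero_mem' := ⟨0, A.graph.zero_mem, A.graph.zero_mem⟩
  smul_mem' := by
    rintro c x ⟨y, hxy, hyx⟩
    exact ⟨c • y, A.graph.smul_mem c hxy, A.graph.smul_mem c hyx⟩

end LinearPMap

section SelfAdjointLinearPMap

variable {𝕜 E : Type*} [RCLike 𝕜] [NormedAddCommGroup E] [InnerProductSpace 𝕜 E]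
  [CompleteSpace E] {A : E →ₗ.[𝕜] E}

theorem isSelfAdjoint_toPMap_top_iff {B : E →L[𝕜] E} :
    IsSelfAdjoint ((B : E →ₗ[𝕜] E).toPMap ⊤) ↔ IsSelfAdjoint B := by
  rw [LinearPMap.isSelfAdjoint_def, isSelfAdjoint_iff, ContinuousLinearMap.star_eq_adjoint,
    ContinuousLinearMap.toPMap_adjoint_eq_adjoint_toPMap_of_dense _ dense_univ]
  refine ⟨fun h => ContinuousLinearMap.ext fun x => ?_, fun h => by rw [h]⟩
  rw [← mem_graph_toPMap_top, h, mem_graph_toPMap_top]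

theorem inner_eq_of_mem_graph (hA : IsSelfAdjoint A) {x y x' y' : E}
    (h : (x, y) ∈ A.graph) (h' : (x', y') ∈ A.graph) : inner 𝕜 y x' = inner 𝕜 x y' := by
  obtain ⟨a, rfl, rfl⟩ := (LinearPMap.mem_graph_iff _).1 h
  obtain ⟨b, rfl, rfl⟩ := (LinearPMap.mem_graph_iff _).1 h'
  have hformal := LinearPMap.adjoint_isFormalAdjoint hA.dense_domain
  rw [LinearPMap.isSelfAdjoint_def.1 hA] at hformal
  exact hformal a b

theorem norm_eq_of_mem_graph_of_mem_graph (hA : IsSelfAdjoint A) {x y : E}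
    (h : (x, y) ∈ A.graph) (h' : (y, x) ∈ A.graph) : ‖y‖ = ‖x‖ := by
  rw [norm_eq_sqrt_re_inner (𝕜 := 𝕜) y, inner_eq_of_mem_graph hA h h',
    ← norm_eq_sqrt_re_inner]

end SelfAdjointLinearPMap

section ExpUnitary

variable {A : Type*} [NormedRing A] [NormedAlgebra ℂ A] [StarRing A] [ContinuousStar A]
  [CompleteSpace A] [StarModule ℂ A]

theorem expUnitary_zero_smul (b : selfAdjoint A) :
    selfAdjoint.expUnitary ((0 : ℝ) • b) = 1 := by
  rw [zero_smul, selfAdjoint.expUnitary_zero]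

theorem expUnitary_add_smul (b : selfAdjoint A) (s t : ℝ) :
    selfAdjoint.expUnitary ((s + t) • b) =
      selfAdjoint.expUnitary (s • b) * selfAdjoint.expUnitary (t • b) := by
  rw [add_smul]
  exact Commute.expUnitary_add (((Commute.refl (b : A)).smul_left s).smul_right t)

theorem hasDerivAt_expUnitary_smul (b : selfAdjoint A) (t : ℝ) :
    HasDerivAt (fun s : ℝ => (selfAdjoint.expUnitary (s • b) : A))
      (selfAdjoint.expUnitary (t • b) * (I • (b : A))) t := by
  have expUnitary_eq (s : ℝ) :
      (selfAdjoint.expUnitary (s • b) : A) = NormedSpace.exp (s • (I • (b : A))) := by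
    rw [selfAdjoint.expUnitary_coe, selfAdjoint.val_smul, smul_comm]
  simp only [expUnitary_eq]
  exact hasDerivAt_exp_smul_const (𝕂 := ℝ) (I • (b : A)) t

end ExpUnitary

section UnitaryGroups

variable {E : Type*} [NormedAddCommGroup E] [InnerProductSpace ℂ E] [CompleteSpace E]

theorem norm_unitary_smul (U : unitary (E →L[ℂ] E)) (ψ : E) : ‖U • ψ‖ = ‖ψ‖ :=
  (Unitary.linearIsometryEquiv U).norm_map ψ

theorem inner_unitary_smul_unitary_smul (U : unitary (E →L[ℂ] E)) (φ ψ : E) :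
    inner ℂ (U • φ) (U • ψ) = inner ℂ φ ψ :=
  (Unitary.linearIsometryEquiv U).inner_map_map φ ψ

theorem mem_graph_generator_iff {U : ℝ → unitary (E →L[ℂ] E)} {ψ χ : E} :
    (ψ, χ) ∈ (generator U).graph ↔ HasDerivAt (fun t => U t • ψ) (I • χ) 0 := by
  have generator_apply (φ : (generator U).domain) :
      generator U φ = -I • deriv (fun t => U t • (φ : E)) 0 := rfl
  rw [LinearPMap.mem_graph_iff]
  constructor
  · rintro ⟨φ, rfl, rfl⟩
    have hφ : DifferentiableAt ℝ (fun t => U t • (φ : E)) 0 := φ.2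
    simpa [generator_apply, smul_smul] using hφ.hasDerivAt
  · intro h
    exact ⟨⟨ψ, h.differentiableAt⟩, rfl, by simp [generator_apply, h.deriv, smul_smul]⟩

theorem IsUnitaryGroup.hasDerivAt {U : ℝ → unitary (E →L[ℂ] E)} (hU : IsUnitaryGroup U) {ψ χ : E}
    (h : (ψ, χ) ∈ (generator U).graph) (t : ℝ) :
    HasDerivAt (fun s => U s • ψ) (I • U t • χ) t := by
  have hshift : HasDerivAt (fun s => U (s - t) • ψ) (I • χ) t :=
    HasDerivAt.comp_sub_const t t (by simpa using mem_graph_generator_iff.1 h)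
  have hmul := ((U t : E →L[ℂ] E).restrictScalars ℝ).hasFDerivAt.comp_hasDerivAt t hshift
  rw [smul_comm]
  refine hmul.congr_of_eventuallyEq (.of_forall fun s => ?_)
  change U s • ψ = U t • U (s - t) • ψ
  rw [← mul_smul, ← hU.map_add, add_sub_cancel]

theorem hasDerivAt_exp_I_mul_real (c t : ℝ) :
    HasDerivAt (fun s : ℝ => exp (I * c * s)) (I * c * exp (I * c * t)) t := by
  simpa [mul_comm] using ((ofRealCLM.hasDerivAt (x := t)).const_mul (I * c)).cexp

theorem IsUnitaryGroup.mem_eigenspace_generator_iff {U : ℝ → unitary (E →L[ℂ] E)}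
    (hU : IsUnitaryGroup U) {c : ℝ} {ψ : E} :
    ψ ∈ eigenspace (generator U) c ↔ ∀ t, U t • ψ = exp (I * c * t) • ψ := by
  have mem_eigenspace_iff : ψ ∈ eigenspace (generator U) c ↔
    (ψ, (c : ℂ) • ψ) ∈ (generator U).graph := Iff.rfl
  rw [mem_eigenspace_iff]
  constructor
  · intro h t
    have hderiv (s : ℝ) : HasDerivAt (fun s : ℝ => exp (I * (-c : ℝ) * s) • U s • ψ) 0 s := by
      convert! (hasDerivAt_exp_I_mul_real (-c) s).smul (hU.hasDerivAt h s) using 1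
      rw [smul_comm (U s) (c : ℂ) ψ]
      generalize U s • ψ = φ
      push_cast
      module
    have hconst : exp (I * (-c : ℝ) * t) • U t • ψ = ψ := by
      simpa [hU.map_zero] using is_const_of_deriv_eq_zero
        (fun s => (hderiv s).differentiableAt) (fun s => (hderiv s).deriv) t 0
    conv_rhs => rw [← hconst, smul_smul, ← exp_add]
    simp
  · intro h
    rw [mem_graph_generator_iff]
    simpa [h, mul_smul] using (hasDerivAt_exp_I_mul_real c 0).smul_const ψ

/-- The operators `A` for which `expI A` is, as intended, a one-parameter group with generator
`A`. By Stone's theorem these are the selfadjoint operators, but this is shown here only for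
bounded ones. -/
def IsGenerator (A : E →ₗ.[ℂ] E) : Prop :=
  ∃ U : ℝ → unitary (E →L[ℂ] E), IsUnitaryGroup U ∧ generator U = A

theorem isUnitaryGroup_expI (A : E →ₗ.[ℂ] E) : IsUnitaryGroup (expI A) := by
  unfold expI
  split_ifs with h
  · exact h.choose_spec.1
  · exact ⟨rfl, fun _ _ => (one_mul 1).symm, fun _ => continuous_const⟩

theorem IsGenerator.generator_expI {A : E →ₗ.[ℂ] E} (hA : IsGenerator A) :
    generator (expI A) = A := by
  unfold expI
  simp only [dif_pos (show ∃ U, IsUnitaryGroup U ∧ generator U = A from hA)]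
  exact hA.choose_spec.2

theorem expI_neg (A : E →ₗ.[ℂ] E) (t : ℝ) : expI A (-t) = (expI A t)⁻¹ := by
  rw [eq_inv_iff_mul_eq_one, ← (isUnitaryGroup_expI A).map_add, neg_add_cancel,
    (isUnitaryGroup_expI A).map_zero]

theorem IsGenerator.expI_smul_of_mem_eigenspace {A : E →ₗ.[ℂ] E} (hA : IsGenerator A) {c : ℝ}
    {ψ : E} (hψ : ψ ∈ eigenspace A c) (t : ℝ) : expI A t • ψ = exp (I * c * t) • ψ :=
  (isUnitaryGroup_expI A).mem_eigenspace_generator_iff.1 (hA.generator_expI.symm ▸ hψ) t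

/-- The eigenvectors `φ + χ` and `φ - χ` pick up the phases `I` and `-I`. -/
theorem IsGenerator.expI_half_pi_smul {A : E →ₗ.[ℂ] E} (hA : IsGenerator A) {φ χ : E}
    (hφχ : (φ, χ) ∈ A.graph) (hχφ : (χ, φ) ∈ A.graph) :
    expI A (Real.pi / 2) • φ = I • χ := by
  have hplus : φ + χ ∈ eigenspace A (1 : ℝ) := by
    simpa [eigenspace, add_comm] using A.graph.add_mem hφχ hχφ
  have hminus : φ - χ ∈ eigenspace A (-1 : ℝ) := by
    simpa [eigenspace] using A.graph.sub_mem hφχ hχφ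
  have exp_plus : exp (I * (1 : ℝ) * (Real.pi / 2 : ℝ)) = I := by
    simp [mul_comm I, exp_pi_div_two_mul_I]
  have exp_minus : exp (I * (-1 : ℝ) * (Real.pi / 2 : ℝ)) = -I := by
    simp [mul_comm I, exp_neg, exp_pi_div_two_mul_I]
  calc expI A (Real.pi / 2) • φ
      = expI A (Real.pi / 2) • (1 / 2 : ℂ) • ((φ + χ) + (φ - χ)) := by congr 1; module
    _ = (1 / 2 : ℂ) • (I • (φ + χ) + -I • (φ - χ)) := by
      rw [smul_comm, smul_add, hA.expI_smul_of_mem_eigenspace hplus,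
        hA.expI_smul_of_mem_eigenspace hminus, exp_plus, exp_minus]
    _ = I • χ := by module

theorem isUnitaryGroup_expUnitary (B : selfAdjoint (E →L[ℂ] E)) :
    IsUnitaryGroup fun t : ℝ => (selfAdjoint.expUnitary (t • B) : unitary (E →L[ℂ] E)) where
  map_zero := expUnitary_zero_smul B
  map_add := expUnitary_add_smul B
  strongCont _ := continuous_iff_continuousAt.2 fun t =>
    (hasDerivAt_expUnitary_smul B t).continuousAt.clm_apply continuousAt_const

theorem generator_expUnitary (B : selfAdjoint (E →L[ℂ] E)) :
    generator (fun t : ℝ => (selfAdjoint.expUnitary (t • B) : unitary (E →L[ℂ] E))) =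
      ((B : E →L[ℂ] E) : E →ₗ[ℂ] E).toPMap ⊤ := by
  refine LinearPMap.eq_of_eq_graph (Submodule.ext fun ⟨ψ, χ⟩ => ?_)
  have hderiv : HasDerivAt (fun t : ℝ => (selfAdjoint.expUnitary (t • B) : E →L[ℂ] E) ψ)
      (I • (B : E →L[ℂ] E) ψ) 0 := by
    have h := ((ContinuousLinearMap.apply ℂ E ψ).restrictScalars ℝ).hasFDerivAt.comp_hasDerivAt 0
      (hasDerivAt_expUnitary_smul B 0)
    rwa [expUnitary_zero_smul] at h
  rw [mem_graph_generator_iff, mem_graph_toPMap_top]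
  exact ⟨fun h => smul_right_injective E I_ne_zero (hderiv.unique h), fun h => h ▸ hderiv⟩

theorem isGenerator_toPMap_top {B : E →L[ℂ] E} (hB : IsSelfAdjoint B) :
    IsGenerator ((B : E →ₗ[ℂ] E).toPMap ⊤) :=
  ⟨_, isUnitaryGroup_expUnitary ⟨B, hB⟩, generator_expUnitary ⟨B, hB⟩⟩

theorem isGenerator_idOp : IsGenerator (idOp : E →ₗ.[ℂ] E) :=
  isGenerator_toPMap_top (B := .id ℂ E) (.one _)

theorem expI_idOp_smul (t : ℝ) (ψ : E) : expI (idOp : E →ₗ.[ℂ] E) t • ψ = exp (I * t) • ψ := by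
  have hψ : ψ ∈ eigenspace idOp ((1 : ℝ) : ℂ) :=
    mem_graph_toPMap_top (B := .id ℂ E).2 (by simp)
  simpa using isGenerator_idOp.expI_smul_of_mem_eigenspace hψ t

end UnitaryGroups

section Fourier

open AddCircle

variable {T : ℝ} [Fact (0 < T)]

theorem eq_zero_of_fourierCoeff_eq_zero {g : C(AddCircle T, ℂ)} (h : ∀ n, fourierCoeff g n = 0) :
    g = 0 := by
  have h' : fourierCoeff g = 0 := funext h
  ext x
  have hsum := has_pointwise_sum_fourier_series_of_summable (by rw [h']; exact summable_zero) x
  exact hsum.unique (by simp [h'])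

end Fourier

section Sectors

variable {E : Type*} [NormedAddCommGroup E] [InnerProductSpace ℂ E] [CompleteSpace E]
  {π : Circle →* unitary (E →L[ℂ] E)}

theorem isUnitaryGroup_circleExp (hπ : StronglyContinuous π) :
    IsUnitaryGroup fun α : ℝ => π (Circle.exp α) where
  map_zero := by simp
  map_add s t := by simp [Circle.exp_add]
  strongCont ψ := (hπ ψ).comp Circle.exp.continuous

theorem mem_sector_iff (hπ : StronglyContinuous π) {μ : ℤ} {ψ : E} :
    ψ ∈ sector π μ ↔ ∀ z : Circle, π z • ψ = (z : ℂ) ^ μ • ψ := by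
  have hmem : ψ ∈ sector π μ ↔ ψ ∈ eigenspace (charge π) ((μ : ℝ) : ℂ) := by
    rw [ofReal_intCast]; rfl
  rw [hmem, charge, (isUnitaryGroup_circleExp hπ).mem_eigenspace_generator_iff,
    Circle.exp_surjective.forall]
  refine forall_congr' fun α => ?_
  rw [Circle.coe_exp, ← exp_int_mul, ofReal_intCast, mul_assoc, mul_left_comm, mul_comm I]

theorem isOrtho_sector (hπ : StronglyContinuous π) {μ ν : ℤ} (hμν : μ ≠ ν) :
    sector π μ ⟂ sector π ν := by
  refine Submodule.isOrtho_iff_inner_eq.2 fun φ hφ ψ hψ => ?_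
  have hne : ((ν : ℂ) - μ) ≠ 0 := sub_ne_zero.2 (by exact_mod_cast hμν.symm)
  let z : Circle := Circle.exp (Real.pi / (ν - μ))
  have hz : (z : ℂ) ^ (ν - μ) = -1 := by
    rw [Circle.coe_exp, ← exp_int_mul, ← exp_pi_mul_I]
    push_cast
    field_simp
  have h : inner ℂ φ ψ = -inner ℂ φ ψ := by
    calc inner ℂ φ ψ = inner ℂ (π z • φ) (π z • ψ) :=
          (inner_unitary_smul_unitary_smul (π z) φ ψ).symm
      _ = (z : ℂ) ^ (ν - μ) * inner ℂ φ ψ := by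
          rw [(mem_sector_iff hπ).1 hφ, (mem_sector_iff hπ).1 hψ, inner_smul_left,
            inner_smul_right, map_zpow₀, ← Circle.coe_inv_eq_conj, Circle.coe_inv, inv_zpow',
            ← mul_assoc, ← zpow_add₀ z.coe_ne_zero, neg_add_eq_sub]
      _ = -inner ℂ φ ψ := by rw [hz, neg_one_mul]
  exact self_eq_neg.1 h

open MeasureTheory AddCircle

theorem integrable_fourier_smul_orbit (hπ : StronglyContinuous π) {T : ℝ} [Fact (0 < T)] (n : ℤ)
    (ψ : E) : Integrable (fun x : AddCircle T => fourier n x • π x.toCircle • ψ) haarAddCircle :=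
  ((fourier n).continuous.smul
    ((hπ ψ).comp continuous_toCircle)).integrable_of_hasCompactSupport (.of_compactSpace _)

theorem fourierCoeff_orbit_mem_sector (hπ : StronglyContinuous π) {T : ℝ} [hT : Fact (0 < T)]
    (ψ : E) (n : ℤ) :
    fourierCoeff (fun x : AddCircle T => π x.toCircle • ψ) n ∈ sector π n := by
  rw [mem_sector_iff hπ, (homeomorphCircle hT.out.ne').surjective.forall]
  intro y
  rw [homeomorphCircle_apply]
  have hfourier (x : AddCircle T) :
      fourier (-n) x = (y.toCircle : ℂ) ^ n * fourier (-n) (y + x) := by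
    rw [fourier_apply, fourier_apply, smul_add, toCircle_add, toCircle_zsmul y, Circle.coe_mul,
      Circle.coe_zpow, zpow_neg, mul_inv_cancel_left₀ (zpow_ne_zero n y.toCircle.coe_ne_zero)]
  have hshift (x : AddCircle T) : π y.toCircle • fourier (-n) x • π x.toCircle • ψ =
      (y.toCircle : ℂ) ^ n • fourier (-n) (y + x) • π (y + x).toCircle • ψ := by
    rw [toCircle_add, map_mul, mul_smul, smul_comm (π y.toCircle), hfourier x, mul_smul]
  calc π y.toCircle • fourierCoeff (fun x : AddCircle T => π x.toCircle • ψ) n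
      = ∫ x, π y.toCircle • fourier (-n) x • π x.toCircle • ψ ∂haarAddCircle :=
        ((π y.toCircle : E →L[ℂ] E).integral_comp_comm
          (integrable_fourier_smul_orbit hπ (-n) ψ)).symm
    _ = (y.toCircle : ℂ) ^ n •
          ∫ x, fourier (-n) (y + x) • π (y + x).toCircle • ψ ∂haarAddCircle := by
        simp_rw [hshift, integral_smul]
    _ = (y.toCircle : ℂ) ^ n • fourierCoeff (fun x : AddCircle T => π x.toCircle • ψ) n := by
        rw [integral_add_left_eq_self (μ := haarAddCircle)
          (fun x => fourier (-n) x • π x.toCircle • ψ) y, fourierCoeff]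

theorem orthogonal_iSup_sector (hπ : StronglyContinuous π) : (⨆ μ, sector π μ)ᗮ = ⊥ := by
  rw [Submodule.eq_bot_iff]
  intro ψ hψ
  let g : C(UnitAddCircle, ℂ) := ⟨fun x => inner ℂ ψ (π x.toCircle • ψ),
    continuous_const.inner ((hπ ψ).comp continuous_toCircle)⟩
  have hg : g = 0 := eq_zero_of_fourierCoeff_eq_zero fun n =>
    calc fourierCoeff g n
        = ∫ x, inner ℂ ψ (fourier (-n) x • π x.toCircle • ψ) ∂haarAddCircle := by
          simp_rw [inner_smul_right]; rfl
      _ = inner ℂ ψ (fourierCoeff (fun x : UnitAddCircle => π x.toCircle • ψ) n) :=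
          integral_inner (integrable_fourier_smul_orbit hπ (-n) ψ) ψ
      _ = 0 := Submodule.inner_left_of_mem_orthogonal
          (Submodule.mem_iSup_of_mem n (fourierCoeff_orbit_mem_sector hπ ψ n)) hψ
  simpa [g] using DFunLike.congr_fun hg 0

theorem dense_iSup_sector (hπ : StronglyContinuous π) :
    Dense ((⨆ μ, sector π μ : Submodule ℂ E) : Set E) := by
  rw [Submodule.dense_iff_topologicalClosure_eq_top, Submodule.topologicalClosure_eq_top_iff,
    orthogonal_iSup_sector hπ]

theorem eq_of_forall_inner_sector_eq (hπ : StronglyContinuous π) {φ ψ : E}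
    (h : ∀ μ, ∀ χ ∈ sector π μ, inner ℂ χ φ = inner ℂ χ ψ) : φ = ψ := by
  rw [← sub_eq_zero, ← Submodule.mem_bot ℂ, ← orthogonal_iSup_sector hπ,
    ← Submodule.iInf_orthogonal, Submodule.mem_iInf]
  exact fun μ χ hχ => by rw [inner_sub_right, h μ χ hχ, sub_self]

end Sectors

section SectorProj

variable {E : Type*} [NormedAddCommGroup E] [InnerProductSpace ℂ E] [CompleteSpace E]
  {π : Circle →* unitary (E →L[ℂ] E)} [∀ μ, FiniteDimensional ℂ (sector π μ)]

theorem sectorProj_mem (μ : ℤ) (ψ : E) : sectorProj π μ ψ ∈ sector π μ :=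
  Submodule.starProjection_apply_mem _ _

theorem sectorProj_eq_self {μ : ℤ} {ψ : E} (h : ψ ∈ sector π μ) : sectorProj π μ ψ = ψ :=
  Submodule.starProjection_eq_self_iff.2 h

theorem sectorProj_eq_zero_of_ne (hπ : StronglyContinuous π) {μ ν : ℤ} (hμν : μ ≠ ν) {ψ : E}
    (h : ψ ∈ sector π ν) : sectorProj π μ ψ = 0 :=
  (Submodule.starProjection_apply_eq_zero_iff _).2 (isOrtho_sector hπ hμν.symm h)

theorem inner_sectorProj (μ : ℤ) (φ ψ : E) :
    inner ℂ (sectorProj π μ φ) ψ = inner ℂ φ (sectorProj π μ ψ) :=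
  Submodule.inner_starProjection_left_eq_right _ _ _

theorem sectorProj_eq_zero_of_sector_eq_bot {μ : ℤ} (hμ : sector π μ = ⊥) (ψ : E) :
    sectorProj π μ ψ = 0 := by
  simpa [hμ] using sectorProj_mem (π := π) μ ψ

theorem eq_of_forall_sectorProj_eq (hπ : StronglyContinuous π) {φ ψ : E}
    (h : ∀ μ, sectorProj π μ φ = sectorProj π μ ψ) : φ = ψ :=
  eq_of_forall_inner_sector_eq hπ fun μ χ hχ => by
    rw [← sectorProj_eq_self hχ, inner_sectorProj, h, inner_sectorProj]

theorem sectorProj_sum (hπ : StronglyContinuous π) (s : Finset ℤ) {f : ℤ → E}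
    (hf : ∀ ν, f ν ∈ sector π ν) (μ : ℤ) :
    sectorProj π μ (∑ ν ∈ s, f ν) = if μ ∈ s then f μ else 0 := by
  have hterm (ν : ℤ) : sectorProj π μ (f ν) = if μ = ν then f ν else 0 := by
    split_ifs with h
    · exact sectorProj_eq_self (h ▸ hf ν)
    · exact sectorProj_eq_zero_of_ne hπ h (hf ν)
  simp_rw [map_sum, hterm, Finset.sum_ite_eq]

theorem eq_sum_sectorProj (hπ : StronglyContinuous π) {s : Finset ℤ} {ψ : E}
    (h : ∀ μ ∉ s, sectorProj π μ ψ = 0) : ψ = ∑ μ ∈ s, sectorProj π μ ψ := by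
  refine eq_of_forall_sectorProj_eq hπ fun μ => ?_
  rw [sectorProj_sum hπ s fun ν => sectorProj_mem ν ψ]
  split_ifs with hμ
  exacts [rfl, h μ hμ]

theorem isFiniteParticle_of_mem_sector (hπ : StronglyContinuous π) {μ : ℤ} {ψ : E}
    (hψ : ψ ∈ sector π μ) : IsFiniteParticle π ψ :=
  (Set.finite_singleton μ).subset fun _ hν =>
    not_imp_comm.1 (fun h => sectorProj_eq_zero_of_ne hπ h hψ) hν

variable (π) in
/-- The vectors all of whose components have charge at most `N`. -/
noncomputable def chargeAtMost (N : ℤ) : Submodule ℂ E :=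
  ⨅ μ > N, (sectorProj π μ).ker

theorem mem_chargeAtMost {N : ℤ} {ψ : E} :
    ψ ∈ chargeAtMost π N ↔ ∀ μ > N, sectorProj π μ ψ = 0 := by
  simp [chargeAtMost]

theorem chargeAtMost_mono : Monotone (chargeAtMost π) := fun _ _ hMN _ hψ =>
  mem_chargeAtMost.2 fun μ hμ => mem_chargeAtMost.1 hψ μ (hMN.trans_lt hμ)

theorem sector_le_chargeAtMost (hπ : StronglyContinuous π) {μ N : ℤ} (hμ : μ ≤ N) :
    sector π μ ≤ chargeAtMost π N := fun _ hψ =>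
  mem_chargeAtMost.2 fun _ hν => sectorProj_eq_zero_of_ne hπ (hμ.trans_lt hν).ne' hψ

theorem exists_mem_chargeAtMost_of_mem_iSup_sector (hπ : StronglyContinuous π) (M : ℤ) {ψ : E}
    (hψ : ψ ∈ ⨆ μ, sector π μ) : ∃ N ≥ M, ψ ∈ chargeAtMost π N := by
  induction hψ using Submodule.iSup_induction' with
  | mem μ ψ hψ =>
    exact ⟨max M μ, le_max_left M μ, sector_le_chargeAtMost hπ (le_max_right M μ) hψ⟩
  | zero => exact ⟨M, le_rfl, zero_mem _⟩
  | add φ ψ _ _ hφ hψ =>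
    obtain ⟨K, hK, hφ⟩ := hφ
    obtain ⟨L, _, hψ⟩ := hψ
    exact ⟨max K L, le_max_of_le_left hK, add_mem (chargeAtMost_mono (le_max_left K L) hφ)
      (chargeAtMost_mono (le_max_right K L) hψ)⟩

end SectorProj

section Reflections

variable {𝕜 F : Type*} [RCLike 𝕜] [NormedAddCommGroup F] [InnerProductSpace 𝕜 F]

theorem reflection_orthogonal_singleton_apply (a x : F) :
    (𝕜 ∙ a)ᗮ.reflection x = x - (2 * (inner 𝕜 a x / (‖a‖ : 𝕜) ^ 2)) • a := by
  rw [Submodule.reflection_orthogonal_apply, Submodule.reflection_singleton_apply]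
  module

theorem coe_reflection_orthogonal_singleton {K : Submodule 𝕜 F} (a x : K) :
    ((𝕜 ∙ a)ᗮ.reflection x : F) = (𝕜 ∙ (a : F))ᗮ.reflection (x : F) := by
  simp [reflection_orthogonal_singleton_apply]

theorem reflection_orthogonal_singleton_sub {x y : F} (hnorm : ‖x‖ = ‖y‖)
    (hinner : inner 𝕜 x y = inner 𝕜 y x) : (𝕜 ∙ (x - y))ᗮ.reflection x = y := by
  have hadd : x + y ∈ (𝕜 ∙ (x - y))ᗮ := by
    rw [Submodule.mem_orthogonal_singleton_iff_inner_right, inner_sub_left, inner_add_right,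
      inner_add_right, hinner, inner_self_eq_norm_sq_to_K, inner_self_eq_norm_sq_to_K, hnorm]
    ring
  have h : (2 : 𝕜) • (𝕜 ∙ (x - y))ᗮ.reflection x = (2 : 𝕜) • y :=
    calc (2 : 𝕜) • (𝕜 ∙ (x - y))ᗮ.reflection x
        = (𝕜 ∙ (x - y))ᗮ.reflection (x - y) + (𝕜 ∙ (x - y))ᗮ.reflection (x + y) := by
          rw [← map_smul, ← map_add]
          congr 1
          module
      _ = (2 : 𝕜) • y := by
          rw [Submodule.reflection_orthogonalComplement_singleton_eq_neg,
            Submodule.reflection_mem_subspace_eq_self hadd]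
          module
  exact smul_right_injective F two_ne_zero h

theorem exists_norm_smul_eq_and_inner_smul_comm {y : F} (hy : y ≠ 0) (x : F) :
    ∃ c : 𝕜, ‖c • y‖ = ‖x‖ ∧ inner 𝕜 x (c • y) = inner 𝕜 (c • y) x := by
  obtain ⟨θ, hθ, hθx⟩ := RCLike.exists_norm_eq_mul_self (inner 𝕜 x y)
  have hreal : inner 𝕜 x (((‖x‖ / ‖y‖ : ℝ) * θ : 𝕜) • y) =
      ((‖x‖ / ‖y‖ * ‖inner 𝕜 x y‖ : ℝ) : 𝕜) := by
    rw [inner_smul_right, mul_assoc, ← hθx, RCLike.ofReal_mul]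
  refine ⟨(‖x‖ / ‖y‖ : ℝ) * θ, ?_, ?_⟩
  · rw [norm_smul, norm_mul, hθ, mul_one, RCLike.norm_ofReal, abs_of_nonneg (by positivity),
      div_mul_cancel₀ _ (norm_ne_zero_iff.2 hy)]
  · rw [← inner_conj_symm _ x, hreal, RCLike.conj_ofReal]

end Reflections

section HyperplaneReflection

variable {E : Type*} [NormedAddCommGroup E] [InnerProductSpace ℂ E] [CompleteSpace E]

/-- The unitary reflection in the hyperplane orthogonal to `a`. -/
noncomputable def hyperplaneReflection (a : E) : unitary (E →L[ℂ] E) :=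
  Unitary.linearIsometryEquiv.symm (ℂ ∙ a)ᗮ.reflection

theorem hyperplaneReflection_smul (a ψ : E) :
    hyperplaneReflection a • ψ = (ℂ ∙ a)ᗮ.reflection ψ := rfl

theorem hyperplaneReflection_const_smul {c : ℂ} (hc : c ≠ 0) (a : E) :
    hyperplaneReflection (c • a) = hyperplaneReflection a := by
  simp only [hyperplaneReflection, Submodule.span_singleton_smul_eq hc.isUnit]

theorem mul_hyperplaneReflection (U : unitary (E →L[ℂ] E)) (a : E) :
    U * hyperplaneReflection a = hyperplaneReflection (U • a) * U := by
  refine Subtype.ext (ContinuousLinearMap.ext fun ψ => ?_)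
  change U • hyperplaneReflection a • ψ = hyperplaneReflection (U • a) • U • ψ
  simp only [hyperplaneReflection_smul, reflection_orthogonal_singleton_apply, smul_sub,
    smul_comm U, inner_unitary_smul_unitary_smul, norm_unitary_smul]

end HyperplaneReflection

section SpecialUnitary

variable {E : Type*} [NormedAddCommGroup E] [InnerProductSpace ℂ E] [CompleteSpace E]
  {π : Circle →* unitary (E →L[ℂ] E)}

theorem unitary_smul_mem_sector (hπ : StronglyContinuous π) {U : unitary (E →L[ℂ] E)}
    (hU : ∀ z, Commute U (π z)) {μ : ℤ} {ψ : E} (hψ : ψ ∈ sector π μ) : U • ψ ∈ sector π μ := by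
  rw [mem_sector_iff hπ] at hψ ⊢
  intro z
  rw [← mul_smul, ← (hU z).eq, mul_smul, hψ, smul_comm]

theorem commute_hyperplaneReflection (hπ : StronglyContinuous π) {μ : ℤ} {a : E}
    (ha : a ∈ sector π μ) (z : Circle) : Commute (hyperplaneReflection a) (π z) := by
  refine Commute.symm (?_ : π z * _ = _)
  rw [mul_hyperplaneReflection, (mem_sector_iff hπ).1 ha,
    hyperplaneReflection_const_smul (zpow_ne_zero μ z.coe_ne_zero)]

theorem hyperplaneReflection_smul_eq_self_of_ne (hπ : StronglyContinuous π) {μ ν : ℤ}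
    (hμν : μ ≠ ν) {a ψ : E} (ha : a ∈ sector π μ) (hψ : ψ ∈ sector π ν) :
    hyperplaneReflection a • ψ = ψ :=
  Submodule.reflection_mem_subspace_eq_self <|
    Submodule.mem_orthogonal_singleton_iff_inner_right.2 <|
      Submodule.isOrtho_iff_inner_eq.1 (isOrtho_sector hπ hμν) a ha ψ hψ

variable [∀ μ, FiniteDimensional ℂ (sector π μ)]

theorem sectorProj_unitary_smul (hπ : StronglyContinuous π) {U : unitary (E →L[ℂ] E)}
    (hU : ∀ z, Commute U (π z)) (μ : ℤ) (ψ : E) :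
    sectorProj π μ (U • ψ) = U • sectorProj π μ ψ := by
  refine Submodule.eq_starProjection_of_mem_of_inner_eq_zero
    (unitary_smul_mem_sector hπ hU (sectorProj_mem μ ψ)) fun φ hφ => ?_
  rw [← smul_sub, ← smul_inv_smul U φ, inner_unitary_smul_unitary_smul]
  exact Submodule.starProjection_inner_eq_zero _ _
    (unitary_smul_mem_sector hπ (fun z => (hU z).inv_left) hφ)

theorem coe_block_apply (hπ : StronglyContinuous π) {U : unitary (E →L[ℂ] E)}
    (hU : ∀ z, Commute U (π z)) (μ : ℤ) (ψ : sector π μ) :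
    (block π U μ ψ : E) = U • (ψ : E) :=
  sectorProj_eq_self (unitary_smul_mem_sector hπ hU ψ.2)

theorem block_mul (hπ : StronglyContinuous π) {U V : unitary (E →L[ℂ] E)}
    (hU : ∀ z, Commute U (π z)) (hV : ∀ z, Commute V (π z)) (μ : ℤ) :
    block π (U * V) μ = block π U μ * block π V μ := by
  ext ψ
  rw [Module.End.mul_apply, coe_block_apply hπ fun z => (hU z).mul_left (hV z),
    coe_block_apply hπ hU, coe_block_apply hπ hV, mul_smul]

theorem one_mem_specialUnitary (hπ : StronglyContinuous π) :
    (1 : unitary (E →L[ℂ] E)) ∈ specialUnitary π := by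
  have hcomm (z : Circle) : Commute 1 (π z) := Commute.one_left _
  refine ⟨hcomm, fun μ => ?_⟩
  have : block π 1 μ = LinearMap.id := by
    ext ψ
    rw [coe_block_apply hπ hcomm, one_smul, LinearMap.id_apply]
  rw [this, LinearMap.det_id]

theorem mul_mem_specialUnitary (hπ : StronglyContinuous π) {U V : unitary (E →L[ℂ] E)}
    (hU : U ∈ specialUnitary π) (hV : V ∈ specialUnitary π) : U * V ∈ specialUnitary π :=
  ⟨fun z => (hU.1 z).mul_left (hV.1 z), fun μ => by
    rw [block_mul hπ hU.1 hV.1, map_mul, hU.2, hV.2, one_mul]⟩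

theorem det_block_hyperplaneReflection (hπ : StronglyContinuous π) {μ : ℤ} {a : E}
    (ha : a ∈ sector π μ) (ha0 : a ≠ 0) (ν : ℤ) :
    LinearMap.det (block π (hyperplaneReflection a) ν) = if μ = ν then -1 else 1 := by
  have hcomm := commute_hyperplaneReflection hπ ha
  split_ifs with hμν
  · subst hμν
    lift a to sector π μ using ha
    have hblock : block π (hyperplaneReflection (a : E)) μ =
        (ℂ ∙ a)ᗮ.reflection.toLinearMap := by
      ext ψ
      rw [coe_block_apply hπ hcomm]
      exact (coe_reflection_orthogonal_singleton a ψ).symm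
    rw [hblock, Submodule.det_reflection, Submodule.orthogonal_orthogonal,
      finrank_span_singleton (by simpa using ha0), pow_one]
  · have hblock : block π (hyperplaneReflection a) ν = LinearMap.id := by
      ext ψ
      rw [coe_block_apply hπ hcomm, hyperplaneReflection_smul_eq_self_of_ne hπ hμν ha ψ.2,
        LinearMap.id_apply]
    rw [hblock, LinearMap.det_id]

theorem hyperplaneReflection_mul_mem_specialUnitary (hπ : StronglyContinuous π) {μ : ℤ} {a b : E}
    (ha : a ∈ sector π μ) (ha0 : a ≠ 0) (hb : b ∈ sector π μ) (hb0 : b ≠ 0) :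
    hyperplaneReflection a * hyperplaneReflection b ∈ specialUnitary π := by
  have hcomma := commute_hyperplaneReflection hπ ha
  have hcommb := commute_hyperplaneReflection hπ hb
  refine ⟨fun z => (hcomma z).mul_left (hcommb z), fun ν => ?_⟩
  rw [block_mul hπ hcomma hcommb, map_mul, det_block_hyperplaneReflection hπ ha ha0,
    det_block_hyperplaneReflection hπ hb hb0]
  split_ifs <;> simp

theorem exists_specialUnitary_smul_mem_span_singleton (hπ : StronglyContinuous π) {μ : ℤ}
    {x y : E} (hx : x ∈ sector π μ) (hy : y ∈ sector π μ) (hy0 : y ≠ 0) :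
    ∃ U ∈ specialUnitary π, U • x ∈ ℂ ∙ y ∧ ∀ ν ≠ μ, ∀ z ∈ sector π ν, U • z = z := by
  obtain ⟨c, hnorm, hinner⟩ := exists_norm_smul_eq_and_inner_smul_comm (𝕜 := ℂ) hy0 x
  rcases eq_or_ne x (c • y) with rfl | hne
  · refine ⟨1, one_mem_specialUnitary hπ, ?_, fun _ _ _ _ => one_smul _ _⟩
    rw [one_smul]
    exact Submodule.smul_mem _ c (Submodule.mem_span_singleton_self y)
  have hsub : x - c • y ∈ sector π μ := sub_mem hx (Submodule.smul_mem _ c hy)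
  refine ⟨hyperplaneReflection y * hyperplaneReflection (x - c • y),
    hyperplaneReflection_mul_mem_specialUnitary hπ hy hy0 hsub (sub_ne_zero.2 hne), ?_,
    fun ν hν z hz => ?_⟩
  · rw [mul_smul, hyperplaneReflection_smul (x - c • y),
      reflection_orthogonal_singleton_sub hnorm.symm hinner, hyperplaneReflection_smul, map_smul,
      Submodule.reflection_orthogonalComplement_singleton_eq_neg, smul_neg, ← neg_smul]
    exact Submodule.smul_mem _ (-c) (Submodule.mem_span_singleton_self y)
  · rw [mul_smul, hyperplaneReflection_smul_eq_self_of_ne hπ hν.symm hsub hz,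
      hyperplaneReflection_smul_eq_self_of_ne hπ hν.symm hy hz]

theorem exists_specialUnitary_forall_smul_mem_span_singleton (hπ : StronglyContinuous π)
    {x y : ℤ → E} (hx : ∀ μ, x μ ∈ sector π μ) (s : Finset ℤ)
    (hy : ∀ μ ∈ s, y μ ∈ sector π μ ∧ y μ ≠ 0) :
    ∃ U ∈ specialUnitary π, (∀ μ ∈ s, U • x μ ∈ ℂ ∙ y μ) ∧
      ∀ ν ∉ s, ∀ z ∈ sector π ν, U • z = z := by
  induction s using Finset.induction_on with
  | empty => exact ⟨1, one_mem_specialUnitary hπ, by simp, fun _ _ _ _ => one_smul _ _⟩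
  | insert μ s hμ ih =>
    obtain ⟨⟨hyμ, hyμ0⟩, hys⟩ := (Finset.forall_mem_insert _ _ _).1 hy
    obtain ⟨V, hV, hVs, hVfix⟩ := ih hys
    obtain ⟨W, hW, hWμ, hWfix⟩ :=
      exists_specialUnitary_smul_mem_span_singleton hπ (hx μ) hyμ hyμ0
    have hVν (ν : ℤ) : V • x ν ∈ sector π ν := unitary_smul_mem_sector hπ hV.1 (hx ν)
    refine ⟨W * V, mul_mem_specialUnitary hπ hW hV,
      (Finset.forall_mem_insert _ _ _).2 ⟨?_, fun ν hν => ?_⟩, fun ν hν z hz => ?_⟩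
    · rwa [mul_smul, hVfix μ hμ _ (hx μ)]
    · rw [mul_smul, hWfix ν (ne_of_mem_of_not_mem hν hμ) _ (hVν ν)]
      exact hVs ν hν
    · rw [Finset.mem_insert, not_or] at hν
      rw [mul_smul, hVfix ν hν.2 z hz, hWfix ν hν.1 z hz]

end SpecialUnitary

namespace Splitting

variable {E : Type*} [NormedAddCommGroup E] [InnerProductSpace ℂ E] [CompleteSpace E]
  {π : Circle →* unitary (E →L[ℂ] E)} [∀ μ, FiniteDimensional ℂ (sector π μ)] (S : Splitting π)

theorem minus_add_zero_add_plus (ψ : E) : S.minus ψ + S.zero ψ + S.plus ψ = ψ :=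
  DFunLike.congr_fun S.sum_eq_one ψ

theorem zero_zero (ψ : E) : S.zero (S.zero ψ) = S.zero ψ :=
  DFunLike.congr_fun S.zero_proj.isIdempotentElem ψ

theorem Xplus_mem (μ : ℤ) (ψ : E) : S.Xplus μ ψ ∈ sector π μ := sectorProj_mem _ _

theorem Xminus_mem (μ : ℤ) (ψ : E) : S.Xminus μ ψ ∈ sector π μ := sectorProj_mem _ _

theorem Xplus_apply (μ : ℤ) (ψ : E) : S.Xplus μ ψ = S.plus (sectorProj π μ ψ) :=
  (DFunLike.congr_fun (S.plus_comm μ).eq ψ).symm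

theorem Xminus_apply (μ : ℤ) (ψ : E) : S.Xminus μ ψ = S.minus (sectorProj π μ ψ) :=
  (DFunLike.congr_fun (S.minus_comm μ).eq ψ).symm

theorem Xplus_of_mem {μ : ℤ} {ψ : E} (h : ψ ∈ sector π μ) : S.Xplus μ ψ = S.plus ψ := by
  rw [Xplus_apply, sectorProj_eq_self h]

theorem Xminus_of_mem {μ : ℤ} {ψ : E} (h : ψ ∈ sector π μ) : S.Xminus μ ψ = S.minus ψ := by
  rw [Xminus_apply, sectorProj_eq_self h]

theorem Xplus_of_mem_of_ne (hπ : StronglyContinuous π) {μ ν : ℤ} (hμν : μ ≠ ν) {ψ : E}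
    (h : ψ ∈ sector π ν) : S.Xplus μ ψ = 0 := by
  rw [Xplus_apply, sectorProj_eq_zero_of_ne hπ hμν h, map_zero]

theorem Xplus_zero : S.Xplus 0 = 0 := by
  rw [Xplus, ← S.minus_sector_zero, mul_assoc, S.minus_mul_plus, mul_zero]

theorem Xminus_zero : S.Xminus 0 = sectorProj π 0 := S.minus_sector_zero

theorem Xplus_Xplus (μ : ℤ) (ψ : E) : S.Xplus μ (S.Xplus μ ψ) = S.Xplus μ ψ := by
  rw [S.Xplus_of_mem (S.Xplus_mem μ ψ), S.Xplus_apply]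
  exact DFunLike.congr_fun S.plus_proj.isIdempotentElem _

theorem Xminus_Xminus (μ : ℤ) (ψ : E) : S.Xminus μ (S.Xminus μ ψ) = S.Xminus μ ψ := by
  rw [S.Xminus_of_mem (S.Xminus_mem μ ψ), S.Xminus_apply]
  exact DFunLike.congr_fun S.minus_proj.isIdempotentElem _

theorem inner_Xminus (μ : ℤ) (φ ψ : E) :
    inner ℂ (S.Xminus μ φ) ψ = inner ℂ φ (S.Xminus μ ψ) := by
  rw [Xminus_apply, S.minus_proj.isSelfAdjoint.isSymmetric.apply_clm, inner_sectorProj, Xminus,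
    mul_apply_eq_comp]

theorem F_apply (ψ : E) : S.F ψ = sectorProj π 0 ψ + S.Xplus 1 ψ := rfl

theorem F_eq_self_of_mem_sector_zero (hπ : StronglyContinuous π) {ψ : E}
    (hψ : ψ ∈ sector π 0) : S.F ψ = ψ := by
  rw [F_apply, sectorProj_eq_self hψ, S.Xplus_of_mem_of_ne hπ one_ne_zero hψ, add_zero]

theorem F_Xplus_one (hπ : StronglyContinuous π) (ψ : E) : S.F (S.Xplus 1 ψ) = S.Xplus 1 ψ := by
  rw [F_apply, sectorProj_eq_zero_of_ne hπ zero_ne_one (S.Xplus_mem 1 ψ), Xplus_Xplus, zero_add]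

theorem F_F (hπ : StronglyContinuous π) (ψ : E) : S.F (S.F ψ) = S.F ψ := by
  rw [S.F_apply ψ, map_add, S.F_eq_self_of_mem_sector_zero hπ (sectorProj_mem 0 ψ),
    S.F_Xplus_one hπ]

theorem exists_norm_eq_one_Xplus_eq_self {μ : ℤ} (hμ : 1 ≤ μ) :
    ∃ χ : E, ‖χ‖ = 1 ∧ S.Xplus μ χ = χ := by
  obtain ⟨φ, hφ⟩ : ∃ φ, S.Xplus μ φ ≠ 0 := by
    simpa [Xplus] using DFunLike.ne_iff.1 (S.plus_ne_zero μ hμ)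
  exact ⟨((‖S.Xplus μ φ‖ : ℂ)⁻¹) • S.Xplus μ φ, norm_smul_inv_norm hφ,
    by rw [map_smul, Xplus_Xplus]⟩

end Splitting

namespace Splitting.IsCompl

variable {E : Type*} [NormedAddCommGroup E] [InnerProductSpace ℂ E] [CompleteSpace E]
  {π : Circle →* unitary (E →L[ℂ] E)} [∀ μ, FiniteDimensional ℂ (sector π μ)] {S : Splitting π}
  {A : E →ₗ.[ℂ] E}

theorem sector_le_domain (hS : S.IsCompl A) (hπ : StronglyContinuous π) (μ : ℤ) :
    sector π μ ≤ A.domain := fun ψ hψ =>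
  hS.finiteParticle_mem ψ (isFiniteParticle_of_mem_sector hπ hψ)

theorem intertwine_of_mem_graph (hS : S.IsCompl A) {μ : ℤ} (hμ : 1 ≤ μ) {φ χ : E}
    (hφ : IsFiniteParticle π φ) (hφχ : (φ, χ) ∈ A.graph) :
    (S.Xplus (μ + 1) φ, S.Xminus μ χ) ∈ A.graph := by
  obtain ⟨φ, rfl, rfl⟩ := (LinearPMap.mem_graph_iff _).1 hφχ
  obtain ⟨hmem, heq⟩ := hS.intertwine μ hμ φ hφ
  exact heq ▸ A.mem_graph ⟨_, hmem⟩

theorem exists_partialIsometry (hS : S.IsCompl A) (hπ : StronglyContinuous π) {μ : ℤ}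
    (hμ : 1 ≤ μ) :
    ∃ V : E →L[ℂ] E, star V * V = S.Xplus (μ + 1) ∧ V * star V = S.Xminus μ ∧
      ∀ ψ, S.Xminus μ (V ψ) = V ψ ∧ (S.Xplus (μ + 1) ψ, V ψ) ∈ A.graph := by
  obtain ⟨V, hV, hsource, htarget⟩ := hS.partialIsometry μ hμ
  refine ⟨V, hsource, htarget, fun ψ => ?_⟩
  obtain ⟨hmem, heq⟩ := hV ψ
  have hgraph := hS.intertwine_of_mem_graph hμ
    (isFiniteParticle_of_mem_sector hπ (S.Xplus_mem (μ + 1) ψ)) (A.mem_graph ⟨_, hmem⟩)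
  rw [S.Xplus_Xplus, ← heq] at hgraph
  exact ⟨by rw [heq, S.Xminus_Xminus], hgraph⟩

theorem mem_graph_of_partialIsometry (hS : S.IsCompl A) (hA : IsSelfAdjoint A)
    (hπ : StronglyContinuous π) {μ : ℤ} (hμ : 1 ≤ μ) {V : E →L[ℂ] E}
    (hsource : star V * V = S.Xplus (μ + 1))
    (hV : ∀ ψ, S.Xminus μ (V ψ) = V ψ ∧ (S.Xplus (μ + 1) ψ, V ψ) ∈ A.graph) (ψ : E) :
    (V ψ, S.Xplus (μ + 1) ψ) ∈ A.graph := by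
  have hVψ : V ψ ∈ A.domain :=
    hS.sector_le_domain hπ μ ((hV ψ).1 ▸ S.Xminus_mem μ (V ψ))
  obtain ⟨χ, hχ⟩ := LinearPMap.mem_domain_iff.1 hVψ
  suffices χ = S.Xplus (μ + 1) ψ from this ▸ hχ
  refine eq_of_forall_inner_sector_eq hπ fun ν φ hφ => ?_
  obtain ⟨ω, hω⟩ := LinearPMap.mem_domain_iff.1 (hS.sector_le_domain hπ ν hφ)
  have hVφ : S.Xminus μ ω = V φ :=
    A.mem_graph_snd_inj
      (hS.intertwine_of_mem_graph hμ (isFiniteParticle_of_mem_sector hπ hφ) hω) (hV φ).2 rfl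
  calc inner ℂ φ χ = inner ℂ ω (V ψ) := (inner_eq_of_mem_graph hA hω hχ).symm
    _ = inner ℂ ω (S.Xminus μ (V ψ)) := by rw [(hV ψ).1]
    _ = inner ℂ (V φ) (V ψ) := by rw [← S.inner_Xminus, hVφ]
    _ = inner ℂ φ (S.Xplus (μ + 1) ψ) := by
      rw [← hsource, mul_apply_eq_comp, ContinuousLinearMap.star_eq_adjoint,
        ContinuousLinearMap.adjoint_inner_right]

theorem Xplus_mem_involutive (hS : S.IsCompl A) (hA : IsSelfAdjoint A)
    (hπ : StronglyContinuous π) {μ : ℤ} (hμ : 1 ≤ μ) (ψ : E) :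
    S.Xplus (μ + 1) ψ ∈ involutive A := by
  obtain ⟨V, hsource, -, hV⟩ := hS.exists_partialIsometry hπ hμ
  exact ⟨V ψ, (hV ψ).2, hS.mem_graph_of_partialIsometry hA hπ hμ hsource hV ψ⟩

theorem Xminus_mem_involutive (hS : S.IsCompl A) (hA : IsSelfAdjoint A)
    (hπ : StronglyContinuous π) {μ : ℤ} (hμ : 1 ≤ μ) (ψ : E) :
    S.Xminus μ ψ ∈ involutive A := by
  obtain ⟨V, hsource, htarget, hV⟩ := hS.exists_partialIsometry hπ hμ
  rw [← htarget]
  exact ⟨_, hS.mem_graph_of_partialIsometry hA hπ hμ hsource hV (star V ψ), (hV (star V ψ)).2⟩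

theorem minus_sub_sectorProj_zero_mem_involutive (hS : S.IsCompl A) (hA : IsSelfAdjoint A)
    (hπ : StronglyContinuous π) (hpos : ∀ μ < 0, sector π μ = ⊥) {μ : ℤ} {φ : E}
    (hφ : φ ∈ sector π μ) : S.minus φ - sectorProj π 0 φ ∈ involutive A := by
  rw [← S.Xminus_of_mem hφ]
  rcases lt_trichotomy μ 0 with hμ | rfl | hμ
  · simp [(Submodule.mem_bot ℂ).1 (hpos μ hμ ▸ hφ)]
  · simp [S.Xminus_zero]
  · rw [sectorProj_eq_zero_of_ne hπ hμ.ne hφ, sub_zero]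
    exact hS.Xminus_mem_involutive hA hπ hμ φ

theorem plus_sub_Xplus_one_mem_involutive (hS : S.IsCompl A) (hA : IsSelfAdjoint A)
    (hπ : StronglyContinuous π) (hpos : ∀ μ < 0, sector π μ = ⊥) {μ : ℤ} {φ : E}
    (hφ : φ ∈ sector π μ) : S.plus φ - S.Xplus 1 φ ∈ involutive A := by
  rw [← S.Xplus_of_mem hφ]
  rcases eq_or_ne μ 1 with rfl | hμ1
  · simp
  rw [S.Xplus_of_mem_of_ne hπ hμ1.symm hφ, sub_zero]
  rcases lt_trichotomy μ 0 with hμ | rfl | hμ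
  · simp [(Submodule.mem_bot ℂ).1 (hpos μ hμ ▸ hφ)]
  · simp [S.Xplus_zero]
  · obtain ⟨ν, rfl⟩ : ∃ ν, μ = ν + 1 := ⟨μ - 1, by ring⟩
    exact hS.Xplus_mem_involutive hA hπ (by lia) φ

theorem one_sub_F_sub_zero_mem_involutive (hS : S.IsCompl A) (hA : IsSelfAdjoint A)
    (hπ : StronglyContinuous π) (hpos : ∀ μ < 0, sector π μ = ⊥) {ψ : E}
    (hψ : ψ ∈ ⨆ μ, sector π μ) : (1 - S.F - S.zero) ψ ∈ involutive A := by
  have hsup : ⨆ μ, sector π μ ≤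
      (involutive A).comap ((1 - S.F - S.zero : E →L[ℂ] E) : E →ₗ[ℂ] E) := by
    refine iSup_le fun μ φ hφ => ?_
    have heq : (1 - S.F - S.zero) φ =
        (S.minus φ - sectorProj π 0 φ) + (S.plus φ - S.Xplus 1 φ) := by
      calc (1 - S.F - S.zero) φ = φ - S.F φ - S.zero φ := rfl
        _ = (S.minus φ + S.zero φ + S.plus φ) - (sectorProj π 0 φ + S.Xplus 1 φ) - S.zero φ := by
          rw [S.minus_add_zero_add_plus, S.F_apply]
        _ = _ := by abel
    rw [Submodule.mem_comap, ContinuousLinearMap.coe_coe, heq]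
    exact add_mem (hS.minus_sub_sectorProj_zero_mem_involutive hA hπ hpos hφ)
      (hS.plus_sub_Xplus_one_mem_involutive hA hπ hpos hφ)
  exact hsup hψ

theorem exists_norm_le (hS : S.IsCompl A) (hA : IsSelfAdjoint A) (hπ : StronglyContinuous π)
    (hpos : ∀ μ < 0, sector π μ = ⊥) :
    ∃ C, ∀ ψ ∈ ⨆ μ, sector π μ, ∀ χ, (ψ, χ) ∈ A.graph → ‖χ‖ ≤ C * ‖ψ‖ := by
  have hdom : sector π 0 ⊔ sector π 1 ≤ A.domain :=
    sup_le (hS.sector_le_domain hπ 0) (hS.sector_le_domain hπ 1)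
  obtain ⟨C, hC0, hC⟩ := exists_norm_le_of_finiteDimensional A hdom
  let R : E →L[ℂ] E := 1 - S.F - S.zero
  refine ⟨C * ‖S.F‖ + ‖R‖, fun ψ hψ χ hψχ => ?_⟩
  have hF : S.F ψ ∈ sector π 0 ⊔ sector π 1 :=
    Submodule.add_mem_sup (sectorProj_mem 0 ψ) (S.Xplus_mem 1 ψ)
  obtain ⟨χF, hχF⟩ := LinearPMap.mem_domain_iff.1 (hdom hF)
  obtain ⟨χR, hχR, hχR'⟩ := hS.one_sub_F_sub_zero_mem_involutive hA hπ hpos hψ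
  have hzero : (S.zero ψ, 0) ∈ A.graph := by
    obtain ⟨hmem, heq⟩ := hS.zero_on (S.zero ψ) (S.zero_zero ψ)
    exact heq ▸ A.mem_graph ⟨_, hmem⟩
  have hχ : χ = χF + 0 + χR :=
    A.mem_graph_snd_inj hψχ (A.graph.add_mem (A.graph.add_mem hχF hzero) hχR)
      (show ψ = S.F ψ + S.zero ψ + (ψ - S.F ψ - S.zero ψ) by abel)
  calc ‖χ‖ ≤ ‖χF‖ + ‖χR‖ := by rw [hχ, add_zero]; exact norm_add_le _ _
    _ ≤ C * ‖S.F ψ‖ + ‖R ψ‖ :=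
      add_le_add (hC _ hF _ hχF) (norm_eq_of_mem_graph_of_mem_graph hA hχR hχR').le
    _ ≤ C * (‖S.F‖ * ‖ψ‖) + ‖R‖ * ‖ψ‖ := by gcongr <;> exact ContinuousLinearMap.le_opNorm _ _
    _ = (C * ‖S.F‖ + ‖R‖) * ‖ψ‖ := by ring

theorem isGenerator (hS : S.IsCompl A) (hA : IsSelfAdjoint A) (hπ : StronglyContinuous π)
    (hpos : ∀ μ < 0, sector π μ = ⊥) : IsGenerator A := by
  obtain ⟨C, hC⟩ := hS.exists_norm_le hA hπ hpos
  obtain ⟨B, rfl⟩ := exists_eq_toPMap_top hA.isClosed (dense_iSup_sector hπ)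
    (iSup_le (hS.sector_le_domain hπ)) hC
  exact isGenerator_toPMap_top (isSelfAdjoint_toPMap_top_iff.1 hA)

theorem expI_half_pi_smul_Xplus_mem (hS : S.IsCompl A) (hA : IsSelfAdjoint A)
    (hπ : StronglyContinuous π) (hpos : ∀ μ < 0, sector π μ = ⊥) {μ : ℤ} (hμ : 1 ≤ μ) (ψ : E) :
    expI A (Real.pi / 2) • S.Xplus (μ + 1) ψ ∈ sector π μ := by
  obtain ⟨V, hsource, -, hV⟩ := hS.exists_partialIsometry hπ hμ
  rw [(hS.isGenerator hA hπ hpos).expI_half_pi_smul (hV ψ).2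
    (hS.mem_graph_of_partialIsometry hA hπ hμ hsource hV ψ), ← (hV ψ).1]
  exact Submodule.smul_mem _ I (S.Xminus_mem μ _)

end Splitting.IsCompl

section Steering

variable {E : Type*} [NormedAddCommGroup E] [InnerProductSpace ℂ E] [CompleteSpace E]

theorem exists_expI_idOp_smul_eq {c : ℂ} (hc : ‖c‖ = 1) :
    ∃ t, ∀ ψ : E, expI (idOp : E →ₗ.[ℂ] E) t • ψ = c • ψ := by
  obtain ⟨t, rfl⟩ := (Complex.norm_eq_one_iff c).1 hc
  exact ⟨t, fun ψ => by rw [expI_idOp_smul, mul_comm]⟩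

variable {π : Circle →* unitary (E →L[ℂ] E)} [∀ μ, FiniteDimensional ℂ (sector π μ)]

theorem unitary_smul_mem_chargeAtMost (hπ : StronglyContinuous π) {U : unitary (E →L[ℂ] E)}
    (hU : ∀ z, Commute U (π z)) {N : ℤ} {ψ : E} (hψ : ψ ∈ chargeAtMost π N) :
    U • ψ ∈ chargeAtMost π N :=
  mem_chargeAtMost.2 fun μ hμ => by
    rw [sectorProj_unitary_smul hπ hU, mem_chargeAtMost.1 hψ μ hμ, smul_zero]

namespace Splitting

/-- All components of `ψ` of charge `μ ≥ 1` lie in the range of `X₊^(μ)`. This is the position from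
which `exp (i π/2 A)`, for `A` complementary to the charge operator, lowers the charge. -/
def IsLowerable (S : Splitting π) (ψ : E) : Prop :=
  ∀ μ, 1 ≤ μ → S.Xplus μ ψ = sectorProj π μ ψ

variable (S : Splitting π)

theorem exists_specialUnitary_isLowerable (hπ : StronglyContinuous π) {N : ℤ} {ψ : E}
    (hψ : ψ ∈ chargeAtMost π N) :
    ∃ U ∈ specialUnitary π, U • ψ ∈ chargeAtMost π N ∧ S.IsLowerable (U • ψ) := by
  choose! χ hχ using fun μ : ℤ => S.exists_norm_eq_one_Xplus_eq_self (μ := μ)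
  obtain ⟨U, hU, hUχ, -⟩ := exists_specialUnitary_forall_smul_mem_span_singleton hπ
    (fun μ => sectorProj_mem μ ψ) (y := χ) (Finset.Icc 1 N) fun μ hμ => by
      obtain ⟨hnorm, hplus⟩ := hχ μ (Finset.mem_Icc.1 hμ).1
      exact ⟨hplus ▸ S.Xplus_mem μ _, norm_ne_zero_iff.1 (hnorm ▸ one_ne_zero)⟩
  have hUψ := unitary_smul_mem_chargeAtMost hπ hU.1 hψ
  refine ⟨U, hU, hUψ, fun μ hμ => ?_⟩
  rcases lt_or_ge N μ with hNμ | hμN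
  · rw [S.Xplus_apply, mem_chargeAtMost.1 hUψ μ hNμ, map_zero]
  · obtain ⟨c, hc⟩ := Submodule.mem_span_singleton.1 (hUχ μ (Finset.mem_Icc.2 ⟨hμ, hμN⟩))
    rw [S.Xplus_apply, sectorProj_unitary_smul hπ hU.1, ← hc, map_smul,
      ← S.Xplus_of_mem ((hχ μ hμ).2 ▸ S.Xplus_mem μ _), (hχ μ hμ).2]

theorem eq_F_add_sum_of_isLowerable (hπ : StronglyContinuous π)
    (hpos : ∀ μ < 0, sector π μ = ⊥) {N : ℤ} (hN : 1 ≤ N) {ψ : E}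
    (hψ : ψ ∈ chargeAtMost π N) (hlow : S.IsLowerable ψ) :
    ψ = S.F ψ + ∑ μ ∈ Finset.Ioc 1 N, S.Xplus μ ψ := by
  have hIcc : ∀ μ ∉ Finset.Icc 0 N, sectorProj π μ ψ = 0 := fun μ hμ => by
    rw [Finset.mem_Icc, not_and_or, not_le, not_le] at hμ
    exact hμ.elim (fun h => sectorProj_eq_zero_of_sector_eq_bot (hpos μ h) ψ)
      (mem_chargeAtMost.1 hψ μ)
  calc ψ = ∑ μ ∈ Finset.Icc 0 N, sectorProj π μ ψ := eq_sum_sectorProj hπ hIcc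
    _ = sectorProj π 0 ψ + ∑ μ ∈ Finset.Icc 1 N, sectorProj π μ ψ := by
      rw [← Finset.add_sum_Ioc_eq_sum_Icc (zero_le_one.trans hN),
        ← Finset.Icc_add_one_left_eq_Ioc, zero_add]
    _ = sectorProj π 0 ψ + ∑ μ ∈ Finset.Icc 1 N, S.Xplus μ ψ := by
      rw [Finset.sum_congr rfl fun μ hμ => (hlow μ (Finset.mem_Icc.1 hμ).1).symm]
    _ = S.F ψ + ∑ μ ∈ Finset.Ioc 1 N, S.Xplus μ ψ := by
      rw [← Finset.add_sum_Ioc_eq_sum_Icc hN, S.F_apply, add_assoc]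

theorem F_mem_chargeAtMost (hπ : StronglyContinuous π) {N : ℤ} (hN : 1 ≤ N) (ψ : E) :
    S.F ψ ∈ chargeAtMost π N :=
  add_mem (sector_le_chargeAtMost hπ (by lia) (sectorProj_mem 0 ψ))
    (sector_le_chargeAtMost hπ hN (S.Xplus_mem 1 ψ))

namespace IsCompl

variable {S} {A : E →ₗ.[ℂ] E} {G : Subgroup (unitary (E →L[ℂ] E))}

theorem expI_half_pi_smul_mem_chargeAtMost (hS : S.IsCompl A) (hA : IsSelfAdjoint A)
    (hπ : StronglyContinuous π) (hpos : ∀ μ < 0, sector π μ = ⊥) {N : ℤ} (hN : 1 ≤ N) {ψ : E}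
    (hψ : ψ ∈ chargeAtMost π (N + 1)) (hlow : S.IsLowerable ψ) :
    expI A (Real.pi / 2) • ψ ∈ chargeAtMost π N := by
  have hF : S.F (expI A (Real.pi / 2) • S.F ψ) = expI A (Real.pi / 2) • S.F ψ :=
    hS.lowGroup_invariant _ (Subgroup.subset_closure (.inl ⟨_, rfl⟩)) _ (S.F_F hπ ψ)
  rw [S.eq_F_add_sum_of_isLowerable hπ hpos (by lia) hψ hlow, smul_add, ← hF, Finset.smul_sum]
  refine add_mem (S.F_mem_chargeAtMost hπ hN _) (sum_mem fun μ hμ => ?_)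
  rw [Finset.mem_Ioc] at hμ
  have hlowered := hS.expI_half_pi_smul_Xplus_mem hA hπ hpos (μ := μ - 1) (by lia) ψ
  rw [sub_add_cancel] at hlowered
  exact sector_le_chargeAtMost hπ (by lia) hlowered

theorem exists_F_smul_eq (hS : S.IsCompl A) (hA : IsSelfAdjoint A) (hπ : StronglyContinuous π)
    (hpos : ∀ μ < 0, sector π μ = ⊥) (hG : specialUnitary π ⊆ G) (hGA : ∀ t, expI A t ∈ G)
    {N : ℤ} (hN : 1 ≤ N) : ∀ ψ ∈ chargeAtMost π N, ∃ U ∈ G, S.F (U • ψ) = U • ψ := by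
  induction N, hN using Int.leInduction with
  | base =>
    intro ψ hψ
    obtain ⟨U, hU, hUψ, hlow⟩ := S.exists_specialUnitary_isLowerable hπ hψ
    exact ⟨U, hG hU, by simpa using (S.eq_F_add_sum_of_isLowerable hπ hpos le_rfl hUψ hlow).symm⟩
  | succ N hN ih =>
    intro ψ hψ
    obtain ⟨U, hU, hUψ, hlow⟩ := S.exists_specialUnitary_isLowerable hπ hψ
    obtain ⟨W, hW, hF⟩ := ih _ (hS.expI_half_pi_smul_mem_chargeAtMost hA hπ hpos hN hUψ hlow)
    exact ⟨W * (expI A (Real.pi / 2) * U), mul_mem hW (mul_mem (hGA _) (hG hU)), by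
      simpa only [mul_smul] using hF⟩

theorem exists_smul_eq_of_F_eq_self (hS : S.IsCompl A) (hG : specialUnitary π ⊆ G)
    (hGA : ∀ t, expI A t ∈ G) (hGid : ∀ t, expI (idOp : E →ₗ.[ℂ] E) t ∈ G) {χ : E}
    (hχ : ‖χ‖ = 1) (hχF : S.F χ = χ) {φ : E} (hφF : S.F φ = φ) :
    ∃ U ∈ G, U • φ = (‖φ‖ : ℂ) • χ := by
  obtain rfl | hφ0 := eq_or_ne φ 0
  · exact ⟨1, one_mem G, by simp⟩
  have hlowGroup : S.lowGroup A ≤ G :=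
    (Subgroup.closure_le G).2 <|
      Set.union_subset (Set.range_subset_iff.2 hGA) fun _ hU => hG hU.1
  obtain ⟨U, hU, c, hc, hUφ⟩ := hS.lowGroup_transitive ((‖φ‖ : ℂ)⁻¹ • φ) χ
    (norm_smul_inv_norm hφ0) hχ (by rw [map_smul, hφF]) hχF
  obtain ⟨t, ht⟩ := exists_expI_idOp_smul_eq (E := E) (c := c⁻¹) (by rw [norm_inv, hc, inv_one])
  refine ⟨expI idOp t * U, mul_mem (hGid t) (hlowGroup hU), ?_⟩
  have hUφ' : U • φ = (‖φ‖ : ℂ) • c • χ := by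
    rw [← hUφ, map_smul, smul_inv_smul₀ (by simpa using hφ0)]
    rfl
  have hc0 : c ≠ 0 := norm_ne_zero_iff.1 (hc ▸ one_ne_zero)
  rw [mul_smul, ht, hUφ', smul_comm, inv_smul_smul₀ hc0]

theorem exists_smul_eq (hS : S.IsCompl A) (hA : IsSelfAdjoint A) (hπ : StronglyContinuous π)
    (hpos : ∀ μ < 0, sector π μ = ⊥) (hG : specialUnitary π ⊆ G) (hGA : ∀ t, expI A t ∈ G)
    (hGid : ∀ t, expI (idOp : E →ₗ.[ℂ] E) t ∈ G) {χ : E} (hχ : ‖χ‖ = 1) (hχF : S.F χ = χ)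
    {ψ : E} (hψ : ψ ∈ ⨆ μ, sector π μ) : ∃ U ∈ G, U • ψ = (‖ψ‖ : ℂ) • χ := by
  obtain ⟨N, hN, hψN⟩ := exists_mem_chargeAtMost_of_mem_iSup_sector hπ 1 hψ
  obtain ⟨U, hU, hUF⟩ := hS.exists_F_smul_eq hA hπ hpos hG hGA hN ψ hψN
  obtain ⟨W, hW, hWU⟩ := hS.exists_smul_eq_of_F_eq_self hG hGA hGid hχ hχF hUF
  exact ⟨W * U, mul_mem hW hU, by rw [mul_smul, hWU, norm_unitary_smul]⟩

end IsCompl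
end Splitting
end Steering

section Reachability

variable {E : Type*} [NormedAddCommGroup E] [InnerProductSpace ℂ E] [CompleteSpace E]
  {ι : Type*} {A : ι → E →ₗ.[ℂ] E}

theorem propagator_append (A : ι → E →ₗ.[ℂ] E) (ps qs : List (Pulse ι)) :
    propagator A (ps ++ qs) = propagator A qs * propagator A ps := by
  induction ps with
  | nil => simp [propagator]
  | cons p ps ih => simp [propagator, ih, mul_assoc]

theorem propagator_singleton (A : ι → E →ₗ.[ℂ] E) (p : Pulse ι) :
    propagator A [p] = expI (A p.index) (-(p.duration * p.amplitude)) := by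
  simp [propagator]

/-- The pulse that undoes `p`: time cannot run backwards, so the amplitude changes sign. -/
def Pulse.reverse (p : Pulse ι) : Pulse ι := { p with amplitude := -p.amplitude }

theorem propagator_reverse_map_reverse (A : ι → E →ₗ.[ℂ] E) (ps : List (Pulse ι)) :
    propagator A (ps.map Pulse.reverse).reverse = (propagator A ps)⁻¹ := by
  induction ps with
  | nil => simp [propagator]
  | cons p ps ih =>
    rw [List.map_cons, List.reverse_cons, propagator_append, ih, propagator_singleton,
      propagator, mul_inv_rev, ← expI_neg, Pulse.reverse, mul_neg]

theorem reachable_iff {φ ψ : E} : Reachable A φ ψ ↔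
    ∀ ε > 0, ∃ ps : List (Pulse ι), ps ≠ [] ∧ ‖ψ - propagator A ps • φ‖ < ε :=
  Iff.rfl

theorem Reachable.symm {φ ψ : E} (h : Reachable A φ ψ) : Reachable A ψ φ := by
  rw [reachable_iff] at h ⊢
  intro ε hε
  obtain ⟨ps, hps, hlt⟩ := h ε hε
  refine ⟨(ps.map Pulse.reverse).reverse, by simpa using hps, ?_⟩
  rwa [propagator_reverse_map_reverse, ← norm_unitary_smul (propagator A ps), smul_sub,
    smul_inv_smul, norm_sub_rev]

theorem Reachable.trans {φ χ ψ : E} (h₁ : Reachable A φ χ) (h₂ : Reachable A χ ψ) :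
    Reachable A φ ψ := by
  rw [reachable_iff] at h₁ h₂ ⊢
  intro ε hε
  obtain ⟨ps, hps, hφ⟩ := h₁ (ε / 2) (half_pos hε)
  obtain ⟨qs, -, hχ⟩ := h₂ (ε / 2) (half_pos hε)
  refine ⟨ps ++ qs, by simp [hps], ?_⟩
  rw [propagator_append, mul_smul]
  rw [← norm_unitary_smul (propagator A qs), smul_sub] at hφ
  exact (norm_sub_le_norm_sub_add_norm_sub _ _ _).trans_lt (by linarith)

theorem reachable_expI_smul (A : ι → E →ₗ.[ℂ] E) (k : ι) (t : ℝ) (ψ : E) :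
    Reachable A ψ (expI (A k) t • ψ) :=
  reachable_iff.2 fun _ hε =>
    ⟨[⟨k, -t, 1, one_pos⟩], List.cons_ne_nil _ _, by simpa [propagator_singleton] using hε⟩

theorem Reachable.refl [Nonempty ι] (A : ι → E →ₗ.[ℂ] E) (ψ : E) : Reachable A ψ ψ := by
  obtain ⟨k⟩ := ‹Nonempty ι›
  simpa [(isUnitaryGroup_expI (A k)).map_zero] using reachable_expI_smul A k 0 ψ

theorem isClosed_setOf_reachable (A : ι → E →ₗ.[ℂ] E) :
    IsClosed {p : E × E | Reachable A p.1 p.2} := by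
  refine isClosed_of_closure_subset fun ⟨φ, ψ⟩ h => reachable_iff.2 fun ε hε => ?_
  obtain ⟨⟨φ', ψ'⟩, hφψ', hdist⟩ := Metric.mem_closure_iff.1 h (ε / 3) (by positivity)
  obtain ⟨ps, hps, hlt⟩ := reachable_iff.1 hφψ' (ε / 3) (by positivity)
  obtain ⟨hφ, hψ⟩ : ‖φ' - φ‖ < ε / 3 ∧ ‖ψ - ψ'‖ < ε / 3 := by
    rwa [Prod.dist_eq, max_lt_iff, dist_eq_norm, dist_eq_norm, norm_sub_rev φ] at hdist
  rw [← norm_unitary_smul (propagator A ps), smul_sub] at hφ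
  refine ⟨ps, hps, ?_⟩
  calc ‖ψ - propagator A ps • φ‖
      = ‖(ψ - ψ') + (ψ' - propagator A ps • φ') +
          (propagator A ps • φ' - propagator A ps • φ)‖ := by
        rw [sub_add_sub_cancel, sub_add_sub_cancel]
    _ ≤ ‖ψ - ψ'‖ + ‖ψ' - propagator A ps • φ'‖ +
          ‖propagator A ps • φ' - propagator A ps • φ‖ := norm_add₃_le
    _ < ε := by linarith

theorem Reachable.of_forall_exists_norm_sub_lt {φ ψ : E}
    (h : ∀ ε > 0, ∃ χ, Reachable A φ χ ∧ ‖χ - ψ‖ < ε) : Reachable A φ ψ := by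
  have hclosed : IsClosed {χ | Reachable A φ χ} :=
    (isClosed_setOf_reachable A).preimage (by fun_prop : Continuous fun χ => (φ, χ))
  refine hclosed.closure_subset (Metric.mem_closure_iff.2 fun ε hε => ?_)
  obtain ⟨χ, hχ, hlt⟩ := h ε hε
  exact ⟨χ, hχ, by rwa [dist_comm, dist_eq_norm]⟩

/-- The unitaries `U` such that every `U ψ` is reachable from `ψ`. It is strongly closed since
reachability is a closed relation, which is why it contains the dynamical group. -/
def reachableGroup [Nonempty ι] (A : ι → E →ₗ.[ℂ] E) : Subgroup (unitary (E →L[ℂ] E)) where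
  carrier := {U | ∀ ψ, Reachable A ψ (U • ψ)}
  one_mem' ψ := by simpa using Reachable.refl A ψ
  mul_mem' {U V} hU hV ψ := by simpa only [mul_smul] using (hV ψ).trans (hU (V • ψ))
  inv_mem' {U} hU ψ := by simpa only [smul_inv_smul] using (hU (U⁻¹ • ψ)).symm

theorem expI_mem_reachableGroup [Nonempty ι] (A : ι → E →ₗ.[ℂ] E) (k : ι) (t : ℝ) :
    expI (A k) t ∈ reachableGroup A :=
  reachable_expI_smul A k t

theorem isStronglyClosed_reachableGroup [Nonempty ι] (A : ι → E →ₗ.[ℂ] E) :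
    IsStronglyClosed (reachableGroup A : Set (unitary (E →L[ℂ] E))) :=
  fun U hU ψ => .of_forall_exists_norm_sub_lt fun ε hε => by
    obtain ⟨V, hV, hVU⟩ := hU {ψ} ε hε
    exact ⟨V • ψ, hV ψ, hVU ψ (Finset.mem_singleton_self ψ)⟩

theorem dynamicalGroup_le_reachableGroup [Nonempty ι] (A : ι → E →ₗ.[ℂ] E) :
    dynamicalGroup A ≤ reachableGroup A :=
  sInf_le ⟨isStronglyClosed_reachableGroup A, expI_mem_reachableGroup A⟩

theorem dynamicalGroup_comp_le {κ : Type*} (A : ι → E →ₗ.[ℂ] E) (f : κ → ι) :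
    dynamicalGroup (A ∘ f) ≤ dynamicalGroup A :=
  sInf_le_sInf fun _ hG => ⟨hG.1, fun k => hG.2 (f k)⟩

theorem reachable_norm_smul_of_dense {D : Set E} (hD : Dense D) {χ : E}
    (h : ∀ φ ∈ D, Reachable A φ ((‖φ‖ : ℂ) • χ)) (ψ : E) : Reachable A ψ ((‖ψ‖ : ℂ) • χ) :=
  hD.induction h
    ((isClosed_setOf_reachable A).preimage
      (by fun_prop : Continuous fun φ : E => (φ, (‖φ‖ : ℂ) • χ))) ψ

variable {π : Circle →* unitary (E →L[ℂ] E)} [∀ μ, FiniteDimensional ℂ (sector π μ)]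

theorem Splitting.IsCompl.reachable_norm_smul {S : Splitting π} {k i₀ : ι}
    (hS : S.IsCompl (A k)) (hAk : IsSelfAdjoint (A k)) (hid : A i₀ = idOp)
    (hSU : ∀ U ∈ specialUnitary π, U ∈ dynamicalGroup A) (hπ : StronglyContinuous π)
    (hpos : ∀ μ < 0, sector π μ = ⊥) {χ : E} (hχ : ‖χ‖ = 1) (hχF : S.F χ = χ) (ψ : E) :
    Reachable A ψ ((‖ψ‖ : ℂ) • χ) := by
  have : Nonempty ι := ⟨k⟩
  refine reachable_norm_smul_of_dense (dense_iSup_sector hπ) (fun φ hφ => ?_) ψ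
  obtain ⟨U, hU, hUφ⟩ := hS.exists_smul_eq hAk hπ hpos (G := reachableGroup A)
    (fun U hU => dynamicalGroup_le_reachableGroup A (hSU U hU)) (expI_mem_reachableGroup A k)
    (hid ▸ expI_mem_reachableGroup A i₀) hχ hχF hφ
  exact hUφ ▸ hU φ

end Reachability

end QControl

theorem mainTheorem2_general {E : Type*} [NormedAddCommGroup E] [InnerProductSpace ℂ E]
    [CompleteSpace E] (π : Circle →* unitary (E →L[ℂ] E)) (hπ : QControl.StronglyContinuous π)
    [∀ μ : ℤ, FiniteDimensional ℂ (QControl.sector π μ)]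
    (hpos : ∀ μ : ℤ, μ < 0 → QControl.sector π μ = ⊥) {ι : Type*} (A : ι → E →ₗ.[ℂ] E)
    (hid : ∃ i, A i = QControl.idOp)
    (hSU : ∀ U ∈ QControl.specialUnitary π, U ∈ QControl.dynamicalGroup A)
    (hcompl : ∃ k, IsSelfAdjoint (A k) ∧ QControl.IsComplementary π (A k)) :
    QControl.PureStateControllable A := by
  intro ψ₀ ψ hψ₀ hψ
  obtain ⟨i, hi⟩ := hid
  obtain ⟨k, hAk, S, hS⟩ := hcompl
  obtain ⟨χ, hχ, hχX⟩ := S.exists_norm_eq_one_Xplus_eq_self le_rfl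
  have hχF : S.F χ = χ := by rw [← hχX, S.F_Xplus_one hπ]
  have hsteer (φ : E) (hφ : ‖φ‖ = 1) : QControl.Reachable A φ χ := by
    simpa [hφ] using hS.reachable_norm_smul hAk hi hSU hπ hpos hχ hχF φ
  exact (hsteer ψ₀ hψ₀).trans (hsteer ψ hψ).symm

theorem mainTheorem2 {E : Type*} [NormedAddCommGroup E] [InnerProductSpace ℂ E] [CompleteSpace E]
    (π : Circle →* unitary (E →L[ℂ] E)) (hπ : QControl.StronglyContinuous π)
    [∀ μ : ℤ, FiniteDimensional ℂ (QControl.sector π μ)]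
    (hpos : ∀ μ : ℤ, μ < 0 → QControl.sector π μ = ⊥)
    (n : ℕ) (A : Fin (n + 1) → E →ₗ.[ℂ] E) (hA : ∀ k, IsSelfAdjoint (A k))
    (hcomm : ∀ k : Fin n, QControl.CommutesWithCharge π (A k.castSucc))
    (hSU : ∀ U ∈ QControl.specialUnitary π,
      U ∈ QControl.dynamicalGroup fun k : Fin n => A k.castSucc)
    (hcompl : QControl.IsComplementary π (A (Fin.last n))) :
    QControl.PureStateControllable
      (Fin.cons QControl.idOp A : Fin (n + 2) → E →ₗ.[ℂ] E) :=
  mainTheorem2_general π hπ hpos _ ⟨0, rfl⟩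
    (fun U hU => QControl.dynamicalGroup_comp_le (Fin.cons QControl.idOp A)
      (fun k : Fin n => k.castSucc.succ) (hSU U hU))
    ⟨(Fin.last n).succ, hA _, hcompl⟩
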